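/- **Theorem (Bartlett-type decomposition for the inverse-Wishart distribution).** Let $m \ge 0$ be an integer and $n > m-1$ a real number. The upper Cholesky factor of a positive definite matrix $X$ is the unique upper triangular matrix $U$ with positive diagonal entries such that $X = U^\top U$. For a real positive definite $m\times m$ matrix $\Sigma$, the Wishart distribution $W_m(n,\Sigma)$ is, for integer $n$, the law of $YY^\top$, where $Y$ is an $m\times n$ random matrix with independent $N(0,\Sigma)$ columns; for non-integer $n$ it is the probability distribution on positive definite matrices $A$ whose density with respect to Lebesgue measure on the entries $a_{ij}$, $i\le j$, is proportional to $\exp(-\tfrac12\operatorname{tr}(\Sigma^{-1}A))\,(\det A)^{(n-m-1)/2}$. If $A\sim W_m(n,\Omega^{-1})$, then $B=A^{-1}$ has the inverse-Wishart distribution with $n$ degrees of freedom and scale matrix $\Omega$; if $U_\Omega$ is the upper Cholesky factor of $\Omega$, the law of the upper Cholesky factor of $B$ is the Cholesky-inverse-Wishart distribution $\mathrm{CholInvW}_m(n,U_\Omega)$. Let $\Omega$ be a real positive definite $m\times m$ matrix with upper Cholesky factor $U_\Omega$, let $Z=(z_{ij})$ be a random real $m\times m$ matrix that is almost surely upper triangular,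 and suppose that almost surely $U_B = Z^{-1}U_\Omega$ (where $Z^{-1}$ is read as $0$ if $Z$ is singular; each of the two conditions below forces $Z$ to be almost surely invertible). Then $$U_B \sim \mathrm{CholInvW}_m(n,U_\Omega)$$ if and only if the entries $z_{ij}$, $1\le i\le j\le m$, are independent, $z_{ij}\sim N(0,1)$ for $i<j$, and $z_{jj}\sim\chi_{n-m+j}$ for every $j$. Here, for real $k>0$, $\chi_k$ is the distribution on $(0,\infty)$ with density $\frac{2^{1-k/2}}{\Gamma(k/2)}x^{k-1}e^{-x^2/2}$. -/

import Mathlib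

open MeasureTheory ProbabilityTheory Matrix

noncomputable section

namespace InvWishart

/-- Real matrices carry the product `σ`-algebra of their entries. -/
instance instMeasurableSpaceMatrix {ι κ : Type*} : MeasurableSpace (Matrix ι κ ℝ) :=
  inferInstanceAs (MeasurableSpace (ι → κ → ℝ))

/-- The positions `(i, j)` with `i ≤ j` of an `m × m` matrix: they index both the entries of an
upper triangular matrix and the distinct entries of a symmetric matrix. -/
abbrev UpperIdx (m : ℕ) : Type := {p : Fin m × Fin m // p.1 ≤ p.2}

/-- The symmetric matrix with prescribed entries on and above the diagonal. -/
def symmOfUpper {m : ℕ} (x : UpperIdx m → ℝ) : Matrix (Fin m) (Fin m) ℝ :=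
  Matrix.of fun i j => if h : i ≤ j then x ⟨(i, j), h⟩ else x ⟨(j, i), (not_le.mp h).le⟩

/-- `U` is the upper Cholesky factor of `X`: it is upper triangular with positive diagonal
entries, and `X = Uᵀ U`. -/
structure IsUpperCholesky {m : ℕ} (U X : Matrix (Fin m) (Fin m) ℝ) : Prop where
  upper : U.IsUpperTriangular
  diag_pos : ∀ i, 0 < U i i
  eq_mul : X = Uᵀ * U

open Classical in
/-- The upper Cholesky factor of a positive definite matrix (and `0` for a matrix which has no
upper Cholesky factor). -/
def cholU {m : ℕ} (X : Matrix (Fin m) (Fin m) ℝ) : Matrix (Fin m) (Fin m) ℝ :=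
  if h : ∃ U, IsUpperCholesky U X then h.choose else 0

/-- The Wishart distribution with an integer number `n` of degrees of freedom: the law of `Y Yᵀ`,
where the `n` columns of the `m × n` matrix `Y` are independent `N(0, S)` vectors. -/
def wishartGaussian {m : ℕ} (n : ℕ) (S : Matrix (Fin m) (Fin m) ℝ) :
    Measure (Matrix (Fin m) (Fin m) ℝ) :=
  (Measure.pi fun _ : Fin n => multivariateGaussian 0 S).map fun y =>
    (Matrix.of fun a i => y i a) * (Matrix.of fun a i => y i a)ᵀ

open Classical in
/-- The unnormalized Wishart density `exp(-tr(S⁻¹ A) / 2) (det A)^((n - m - 1) / 2)`, supported on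
the positive definite matrices `A`. -/
def wishartWeight {m : ℕ} (n : ℝ) (S A : Matrix (Fin m) (Fin m) ℝ) : ENNReal :=
  if A.PosDef then
    ENNReal.ofReal (Real.exp (-(1 / 2) * (S⁻¹ * A).trace) * A.det ^ ((n - m - 1) / 2))
  else 0

/-- The probability measure on symmetric matrices whose density with respect to Lebesgue measure
on the distinct entries is proportional to `wishartWeight n S`. -/
def wishartOfDensity {m : ℕ} (n : ℝ) (S : Matrix (Fin m) (Fin m) ℝ) :
    Measure (Matrix (Fin m) (Fin m) ℝ) :=
  (∫⁻ x : UpperIdx m → ℝ, wishartWeight n S (symmOfUpper x))⁻¹ •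
    ((volume : Measure (UpperIdx m → ℝ)).withDensity
      fun x => wishartWeight n S (symmOfUpper x)).map symmOfUpper

/-- The Wishart distribution `W_m(n, S)` with `n > m - 1` degrees of freedom and scale matrix `S`.
For integer `n` it is the law of `Y Yᵀ` for a matrix `Y` with `n` independent `N(0, S)` columns;
for other real `n`, where there is no such `Y`, it is given by the Wishart density. -/
def wishart {m : ℕ} (n : ℝ) (S : Matrix (Fin m) (Fin m) ℝ) :
    Measure (Matrix (Fin m) (Fin m) ℝ) :=
  if (⌊n⌋₊ : ℝ) = n then wishartGaussian ⌊n⌋₊ S else wishartOfDensity n S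

/-- The inverse-Wishart distribution with scale matrix `W`: the law of `A⁻¹` for
`A ∼ W_m(n, W⁻¹)`. -/
def invWishart {m : ℕ} (n : ℝ) (W : Matrix (Fin m) (Fin m) ℝ) :
    Measure (Matrix (Fin m) (Fin m) ℝ) :=
  (wishart n W⁻¹).map fun A => A⁻¹

/-- The Cholesky-inverse-Wishart distribution: the law of the upper Cholesky factor of an
inverse-Wishart matrix whose scale matrix has upper Cholesky factor `U`. -/
def cholInvWishart {m : ℕ} (n : ℝ) (U : Matrix (Fin m) (Fin m) ℝ) :
    Measure (Matrix (Fin m) (Fin m) ℝ) :=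
  (invWishart n (Uᵀ * U)).map cholU

/-- The `χ` distribution with `k > 0` (real) degrees of freedom. -/
def chi (k : ℝ) : Measure ℝ :=
  volume.withDensity fun x => ENNReal.ofReal
    (if 0 < x then 2 ^ (1 - k / 2) / Real.Gamma (k / 2) * x ^ (k - 1) * Real.exp (-x ^ 2 / 2)
      else 0)

end InvWishart

end

/-!
The group `UpperPos m` of upper triangular matrices with positive diagonal acts simply transitively
on the positive definite matrices by `A ↦ L A Lᵀ`, so every positive definite `A` is `Z Zᵀ` for a
unique `Z = UpperPos.factor A`, and the upper Cholesky factor of `A⁻¹` is `Z⁻¹`. The theorem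
therefore reduces to the law of `factor A` for a Wishart matrix `A` (`wishart_eq`): if `S = V Vᵀ`, it
is the law of `V Z`, where the entries of `Z` are independent with the stated `χ` and normal laws.

No Jacobian of a nonlinear map is computed. Instead, the uniqueness of σ-finite left invariant
measures on `UpperPos m` is applied to three measures:
* left Haar measure in coordinates, `haarUpper`, which by the change of variables `Z ↦ L Z` has
  density `∏ i ≤ j, (z i i)⁻¹`, and relative to which the law of `Z` has a density proportional to
  `exp (-tr (Z Zᵀ) / 2) (det Z) ^ n` (`exists_bartlettLaw_eq`);
* the image `symmHaar` of `(det A) ^ (-(m + 1) / 2) dA` under `factor`, relative to which the Wishart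
  density is of the same form (`wishartOfDensity_eq`);
* the image `columnHaar` of `(det (Y Yᵀ)) ^ (-N / 2) dY` under `Y ↦ factor (Y Yᵀ)`, for `m × N`
  matrices `Y`, relative to which the Gaussian law is again of that form (`wishartGaussian_eq`).
Their invariance needs only the determinants of the linear maps `Z ↦ L Z`, `A ↦ L A Lᵀ` and
`Y ↦ L Y`, the first two of which are triangular in the coordinates on and above the diagonal. The
constants of proportionality agree because all the laws are probability measures.

For the equivalence, `Z ↦ Z⁻¹ U` is undone by `B ↦ U B⁻¹` on invertible matrices, so the law of `Z` is
determined by that of `Z⁻¹ U`.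
-/

namespace InvWishart

/-! ### The group of upper triangular matrices with positive diagonal -/

instance instBorelSpaceMatrix {m n : ℕ} : BorelSpace (Matrix (Fin m) (Fin n) ℝ) :=
  inferInstanceAs (BorelSpace (Fin m → Fin n → ℝ))

instance instStandardBorelSpaceMatrix {m n : ℕ} :
    StandardBorelSpace (Matrix (Fin m) (Fin n) ℝ) :=
  inferInstanceAs (StandardBorelSpace (Fin m → Fin n → ℝ))

instance instSecondCountableMatrix {m n : ℕ} :
    SecondCountableTopology (Matrix (Fin m) (Fin n) ℝ) :=
  inferInstanceAs (SecondCountableTopology (Fin m → Fin n → ℝ))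

theorem measurable_entry {ι κ : Type*} (i : ι) (j : κ) :
    Measurable fun A : Matrix ι κ ℝ => A i j :=
  (measurable_pi_apply j).comp (measurable_pi_apply (X := fun _ : ι => κ → ℝ) i)

theorem measurable_of_entries {α ι κ : Type*} [MeasurableSpace α] {f : α → Matrix ι κ ℝ}
    (h : ∀ i j, Measurable fun a => f a i j) : Measurable f :=
  measurable_pi_lambda (X := fun _ : ι => κ → ℝ) _ fun i => measurable_pi_lambda _ fun j => h i j

theorem measurable_matrix_mul {l m n : ℕ} :
    Measurable fun p : Matrix (Fin l) (Fin m) ℝ × Matrix (Fin m) (Fin n) ℝ => p.1 * p.2 :=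
  (continuous_fst.matrix_mul continuous_snd).measurable

theorem measurable_matrix_det {m : ℕ} : Measurable (det : Matrix (Fin m) (Fin m) ℝ → ℝ) :=
  (continuous_id.matrix_det).measurable

theorem measurable_matrix_transpose {m n : ℕ} :
    Measurable (transpose : Matrix (Fin m) (Fin n) ℝ → Matrix (Fin n) (Fin m) ℝ) :=
  continuous_id.matrix_transpose.measurable

theorem measurable_matrix_inv {m : ℕ} :
    Measurable fun A : Matrix (Fin m) (Fin m) ℝ => A⁻¹ := by
  refine measurable_of_entries fun i j => ?_
  simp only [Matrix.inv_def, Ring.inverse_eq_inv', Matrix.smul_apply, smul_eq_mul]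
  exact measurable_matrix_det.inv.mul
    ((measurable_entry i j).comp (continuous_id.matrix_adjugate).measurable)

theorem diag_mul_of_isUpperTriangular {m : ℕ} {A B : Matrix (Fin m) (Fin m) ℝ}
    (hA : A.IsUpperTriangular) (hB : B.IsUpperTriangular) (i : Fin m) :
    (A * B) i i = A i i * B i i := by
  rw [Matrix.mul_apply]
  refine Finset.sum_eq_single i (fun j _ hj => ?_) (by simp)
  rcases lt_or_gt_of_ne hj with h | h
  · rw [hA h, zero_mul]
  · rw [hB h, mul_zero]

/-- The upper triangular real `m × m` matrices with positive diagonal entries. -/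
def UpperPos (m : ℕ) : Type :=
  {U : Matrix (Fin m) (Fin m) ℝ // U.IsUpperTriangular ∧ ∀ i, 0 < U i i}

namespace UpperPos

variable {m : ℕ}

theorem upper (U : UpperPos m) : U.1.IsUpperTriangular := U.2.1

theorem diag_pos (U : UpperPos m) (i : Fin m) : 0 < U.1 i i := U.2.2 i

theorem det_eq (U : UpperPos m) : U.1.det = ∏ i, U.1 i i :=
  Matrix.det_of_isUpperTriangular U.upper

theorem det_pos (U : UpperPos m) : 0 < U.1.det := by
  rw [det_eq]
  exact Finset.prod_pos fun i _ => U.diag_pos i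

theorem isUnit_det (U : UpperPos m) : IsUnit U.1.det := U.det_pos.ne'.isUnit

theorem inv_upper (U : UpperPos m) : (U.1⁻¹).IsUpperTriangular := by
  have := Matrix.invertibleOfIsUnitDet _ U.isUnit_det
  exact blockTriangular_inv_of_blockTriangular U.upper

theorem inv_diag_pos (U : UpperPos m) (i : Fin m) : 0 < U.1⁻¹ i i := by
  have h := diag_mul_of_isUpperTriangular U.upper U.inv_upper i
  rw [Matrix.mul_nonsing_inv _ U.isUnit_det, Matrix.one_apply_eq] at h
  exact pos_of_mul_pos_right (h ▸ one_pos) (U.diag_pos i).le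

noncomputable instance : Group (UpperPos m) where
  mul A B := ⟨A.1 * B.1, A.upper.mul B.upper, fun i => by
    rw [diag_mul_of_isUpperTriangular A.upper B.upper]
    exact mul_pos (A.diag_pos i) (B.diag_pos i)⟩
  one := ⟨1, blockTriangular_one, fun i => by simp⟩
  inv A := ⟨A.1⁻¹, A.inv_upper, A.inv_diag_pos⟩
  mul_assoc A B C := Subtype.ext (Matrix.mul_assoc _ _ _)
  one_mul A := Subtype.ext (Matrix.one_mul _)
  mul_one A := Subtype.ext (Matrix.mul_one _)
  inv_mul_cancel A := Subtype.ext (Matrix.nonsing_inv_mul _ A.isUnit_det)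

@[simp] theorem val_mul (A B : UpperPos m) : (A * B).1 = A.1 * B.1 := rfl
@[simp] theorem val_one : (1 : UpperPos m).1 = 1 := rfl
@[simp] theorem val_inv (A : UpperPos m) : (A⁻¹).1 = A.1⁻¹ := rfl

instance : MeasurableSpace (UpperPos m) := Subtype.instMeasurableSpace

theorem measurable_val : Measurable (Subtype.val : UpperPos m → Matrix (Fin m) (Fin m) ℝ) :=
  measurable_subtype_coe

theorem measurableSet_setOf (m : ℕ) :
    MeasurableSet {U : Matrix (Fin m) (Fin m) ℝ | U.IsUpperTriangular ∧ ∀ i, 0 < U i i} := by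
  refine MeasurableSet.inter ?_ ?_
  · have : {U : Matrix (Fin m) (Fin m) ℝ | U.IsUpperTriangular} =
        ⋂ i, ⋂ j, {U | j < i → U i j = 0} := by
      ext U
      simp [Matrix.IsUpperTriangular, Matrix.BlockTriangular]
    change MeasurableSet {U : Matrix (Fin m) (Fin m) ℝ | U.IsUpperTriangular}
    rw [this]
    refine MeasurableSet.iInter fun i => MeasurableSet.iInter fun j => ?_
    by_cases h : j < i
    · simp only [h, forall_const]
      exact measurable_entry i j (measurableSet_singleton (0 : ℝ))
    · simp [h]
  · have : {U : Matrix (Fin m) (Fin m) ℝ | ∀ i, 0 < U i i} = ⋂ i, {U | 0 < U i i} := by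
      ext U; simp
    change MeasurableSet {U : Matrix (Fin m) (Fin m) ℝ | ∀ i, 0 < U i i}
    rw [this]
    exact MeasurableSet.iInter fun i => measurable_entry i i measurableSet_Ioi

instance : StandardBorelSpace (UpperPos m) := (measurableSet_setOf m).standardBorel

instance : MeasurableMul₂ (UpperPos m) where
  measurable_mul := Measurable.subtype_mk <| measurable_matrix_mul.comp <|
    (measurable_val.comp measurable_fst).prodMk (measurable_val.comp measurable_snd)

instance : MeasurableInv (UpperPos m) where
  measurable_inv := Measurable.subtype_mk (measurable_matrix_inv.comp measurable_val)

/-! ### The factorization `A = Z Zᵀ` with `Z` upper triangular -/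

/-- The positive definite matrix `Z Zᵀ`. -/
def gram (Z : UpperPos m) : Matrix (Fin m) (Fin m) ℝ := Z.1 * Z.1ᵀ

theorem gram_mul (L Z : UpperPos m) : gram (L * Z) = L.1 * gram Z * L.1ᵀ := by
  simp [gram, Matrix.mul_assoc]

theorem gram_injective : Function.Injective (gram (m := m)) := by
  intro Z W h
  -- The quotient `Q = W⁻¹ Z` is orthogonal, so `Q⁻¹ = Qᵀ` is upper and lower triangular.
  have hQ : gram (W⁻¹ * Z) = 1 := by
    rw [gram_mul, h, ← gram_mul, inv_mul_cancel]
    simp [gram]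
  generalize hQ' : W⁻¹ * Z = Q at hQ
  have hinv : Q.1⁻¹ = Q.1ᵀ := Matrix.inv_eq_right_inv hQ
  have hlow : ∀ i j, i < j → Q.1 i j = 0 := fun i j hij => by
    have := Q.inv_upper (i := j) (j := i) hij
    rwa [hinv] at this
  have hdiag : ∀ i, Q.1 i i = 1 := fun i => by
    have h1 := diag_mul_of_isUpperTriangular Q.upper Q.inv_upper i
    rw [Matrix.mul_nonsing_inv _ Q.isUnit_det, Matrix.one_apply_eq, hinv,
      Matrix.transpose_apply] at h1
    nlinarith [Q.diag_pos i]
  have : Q = 1 := by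
    refine Subtype.ext (Matrix.ext fun i j => ?_)
    rcases lt_trichotomy i j with hij | hij | hij
    · rw [hlow i j hij, val_one, Matrix.one_apply_ne hij.ne]
    · subst hij; rw [hdiag, val_one, Matrix.one_apply_eq]
    · rw [Q.upper hij, val_one, Matrix.one_apply_ne hij.ne']
  rw [this] at hQ'
  exact (inv_mul_eq_one.mp hQ').symm

theorem measurable_gram : Measurable (gram (m := m)) :=
  measurable_matrix_mul.comp
    (measurable_val.prodMk (measurable_matrix_transpose.comp measurable_val))

theorem measurableEmbedding_gram : MeasurableEmbedding (gram (m := m)) :=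
  measurable_gram.measurableEmbedding gram_injective

theorem gram_posDef (Z : UpperPos m) : (gram Z).PosDef := by
  have h : Function.Injective Z.1.vecMul :=
    Matrix.vecMul_injective_iff_isUnit.mpr ((Matrix.isUnit_iff_isUnit_det _).mpr Z.isUnit_det)
  simpa [gram] using Matrix.PosDef.mul_conjTranspose_self Z.1 h

theorem det_gram (Z : UpperPos m) : (gram Z).det = Z.1.det ^ 2 := by
  simp [gram, sq]

/-- Every positive definite matrix is `Z Zᵀ` for an upper triangular `Z` with positive diagonal.
This comes from the LDL decomposition of the inverse matrix, after adjusting signs. -/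
theorem exists_gram_eq {A : Matrix (Fin m) (Fin m) ℝ} (hA : A.PosDef) : ∃ Z, gram Z = A := by
  have hB := hA.inv
  set K := LDL.lowerInv hB with hK
  set d := LDL.diagEntries hB with hd
  have hKu : IsUnit K := isUnit_of_invertible K
  have hKd : Matrix.diagonal d = K * A⁻¹ * Kᵀ := by
    simpa [LDL.diag] using LDL.diag_eq_lowerInv_conj hB
  have hKup : Kᵀ.IsUpperTriangular := fun i j hij => LDL.lowerInv_triangular hB hij
  have hKdet : K.det ≠ 0 := ((Matrix.isUnit_iff_isUnit_det _).mp hKu).ne_zero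
  have hKdiag : ∀ i, K i i ≠ 0 := fun i => by
    rw [← Matrix.det_transpose, Matrix.det_of_isUpperTriangular hKup] at hKdet
    exact Finset.prod_ne_zero_iff.mp hKdet i (Finset.mem_univ i)
  have hdpos : ∀ i, 0 < d i := by
    have h : (Matrix.diagonal d).PosDef := by
      rw [hKd]
      simpa using hB.mul_mul_conjTranspose_same
        (Matrix.vecMul_injective_iff_isUnit.mpr hKu)
    exact Matrix.posDef_diagonal_iff.mp h
  set e : Fin m → ℝ := fun i => SignType.sign (K i i) / √(d i) with he
  have hee : ∀ i, e i * e i = (d i)⁻¹ := fun i => by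
    have h1 : (SignType.sign (K i i) : ℝ) * SignType.sign (K i i) = 1 := by
      rcases lt_or_gt_of_ne (hKdiag i) with h | h <;> simp [sign_neg, sign_pos, h]
    simp only [he]
    rw [div_mul_div_comm, h1, Real.mul_self_sqrt (hdpos i).le, one_div]
  refine ⟨⟨Kᵀ * Matrix.diagonal e, fun i j hij => ?_, fun i => ?_⟩, ?_⟩
  · rw [Matrix.mul_diagonal, hKup hij, zero_mul]
  · rw [Matrix.mul_diagonal, Matrix.transpose_apply, he]
    simp only
    rw [← mul_div_assoc, self_mul_sign]
    exact div_pos (abs_pos.mpr (hKdiag i)) (Real.sqrt_pos.mpr (hdpos i))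
  · simp only [gram, Matrix.transpose_mul, Matrix.transpose_transpose, Matrix.diagonal_transpose]
    have hAu : IsUnit A.det := hA.det_pos.ne'.isUnit
    have hKu' : IsUnit K.det := hKdet.isUnit
    have hinv : Matrix.diagonal (fun i => (d i)⁻¹) = Kᵀ⁻¹ * A * K⁻¹ := by
      have h1 : (K * A⁻¹ * Kᵀ) * (Kᵀ⁻¹ * A * K⁻¹) = 1 := by
        calc (K * A⁻¹ * Kᵀ) * (Kᵀ⁻¹ * A * K⁻¹)
            = K * (A⁻¹ * ((Kᵀ * Kᵀ⁻¹) * A)) * K⁻¹ := by simp only [Matrix.mul_assoc]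
          _ = 1 := by
            rw [Matrix.mul_nonsing_inv _ (by rwa [Matrix.det_transpose]), Matrix.one_mul,
              Matrix.nonsing_inv_mul _ hAu, Matrix.mul_one, Matrix.mul_nonsing_inv _ hKu']
      have h2 : Matrix.diagonal d * Matrix.diagonal (fun i => (d i)⁻¹) = 1 := by
        rw [Matrix.diagonal_mul_diagonal, ← Matrix.diagonal_one]
        congr 1; ext i; exact mul_inv_cancel₀ (hdpos i).ne'
      rw [← hKd] at h1
      rw [← Matrix.inv_eq_right_inv h1, ← Matrix.inv_eq_right_inv h2]
    calc Kᵀ * Matrix.diagonal e * (Matrix.diagonal e * K)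
        = Kᵀ * (Matrix.diagonal e * Matrix.diagonal e) * K := by simp only [Matrix.mul_assoc]
      _ = (Kᵀ * Kᵀ⁻¹) * A * (K⁻¹ * K) := by
        rw [Matrix.diagonal_mul_diagonal]
        simp only [hee]
        rw [hinv]
        simp only [Matrix.mul_assoc]
      _ = A := by
        rw [Matrix.mul_nonsing_inv _ (by rwa [Matrix.det_transpose]), Matrix.one_mul,
          Matrix.nonsing_inv_mul _ hKu', Matrix.mul_one]

theorem range_gram : Set.range (gram (m := m)) = {A | A.PosDef} := by
  ext A
  exact ⟨fun ⟨Z, h⟩ => h ▸ gram_posDef Z, exists_gram_eq⟩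

theorem measurableSet_posDef (m : ℕ) :
    MeasurableSet {A : Matrix (Fin m) (Fin m) ℝ | A.PosDef} :=
  range_gram ▸ measurableEmbedding_gram.measurableSet_range

/-- The upper triangular `Z` with positive diagonal such that `A = Z Zᵀ`, for positive definite `A`
(and `1` for other matrices). -/
noncomputable def factor (A : Matrix (Fin m) (Fin m) ℝ) : UpperPos m :=
  Function.extend gram id (fun _ => 1) A

@[simp] theorem factor_gram (Z : UpperPos m) : factor (gram Z) = Z :=
  gram_injective.extend_apply _ _ _

theorem gram_factor {A : Matrix (Fin m) (Fin m) ℝ} (hA : A.PosDef) : gram (factor A) = A := by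
  obtain ⟨Z, rfl⟩ := exists_gram_eq hA
  rw [factor_gram]

theorem measurable_factor : Measurable (factor (m := m)) :=
  measurableEmbedding_gram.measurable_extend measurable_id measurable_const

theorem factor_conj (L : UpperPos m) {A : Matrix (Fin m) (Fin m) ℝ} (hA : A.PosDef) :
    factor (L.1 * A * L.1ᵀ) = L * factor A := by
  obtain ⟨Z, rfl⟩ := exists_gram_eq hA
  rw [← gram_mul, factor_gram, factor_gram]

theorem conj_posDef_iff (L : UpperPos m) {A : Matrix (Fin m) (Fin m) ℝ} :
    (L.1 * A * L.1ᵀ).PosDef ↔ A.PosDef := by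
  have hL : IsUnit L.1 := (Matrix.isUnit_iff_isUnit_det _).mpr L.isUnit_det
  have h := hL.posDef_star_right_conjugate_iff (x := A)
  rwa [Matrix.star_eq_conjTranspose, Matrix.conjTranspose_eq_transpose_of_trivial] at h

/-- The upper Cholesky factor of `(Z Zᵀ)⁻¹` is `Z⁻¹`. -/
theorem cholU_inv_gram (Z : UpperPos m) : cholU (gram Z)⁻¹ = Z.1⁻¹ := by
  have hex : ∃ U, IsUpperCholesky U (gram Z)⁻¹ := by
    refine ⟨Z.1⁻¹, Z.inv_upper, Z.inv_diag_pos, ?_⟩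
    rw [gram, Matrix.mul_inv_rev, Matrix.transpose_nonsing_inv]
  rw [cholU, dif_pos hex]
  have hU := hex.choose_spec
  generalize hex.choose = U at hU
  let U' : UpperPos m := ⟨U, hU.upper, hU.diag_pos⟩
  have h : gram U'⁻¹ = gram Z := by
    have h1 := congrArg (·⁻¹) hU.eq_mul
    simp only [Matrix.mul_inv_rev, Matrix.nonsing_inv_nonsing_inv _
      (gram_posDef Z).det_pos.ne'.isUnit] at h1
    rw [h1, gram, val_inv, Matrix.transpose_nonsing_inv]
  rw [← gram_injective h, ← val_inv, inv_inv]

end UpperPos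

/-! ### Coordinates on triangular and on symmetric matrices -/

variable {m : ℕ}

/-- The entries of a matrix on and above the diagonal. -/
def upperCoords (A : Matrix (Fin m) (Fin m) ℝ) : UpperIdx m → ℝ := fun p => A p.1.1 p.1.2

/-- The upper triangular matrix with prescribed entries on and above the diagonal. -/
def triOfUpper (x : UpperIdx m → ℝ) : Matrix (Fin m) (Fin m) ℝ :=
  Matrix.of fun i j => if h : i ≤ j then x ⟨(i, j), h⟩ else 0

/-- The diagonal position `(i, i)`. -/
def diagIdx (i : Fin m) : UpperIdx m := ⟨(i, i), le_rfl⟩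

theorem measurable_upperCoords : Measurable (upperCoords (m := m)) :=
  measurable_pi_lambda _ fun _ => measurable_entry _ _

theorem measurable_triOfUpper : Measurable (triOfUpper (m := m)) := by
  refine measurable_of_entries fun i j => ?_
  by_cases h : i ≤ j
  · simpa [triOfUpper, h] using measurable_pi_apply _
  · simp [triOfUpper, h]

theorem measurable_symmOfUpper : Measurable (symmOfUpper (m := m)) := by
  refine measurable_of_entries fun i j => ?_
  by_cases h : i ≤ j
  · simpa [symmOfUpper, h] using measurable_pi_apply _
  · simpa [symmOfUpper, h] using measurable_pi_apply _

@[simp] theorem upperCoords_triOfUpper (x : UpperIdx m → ℝ) : upperCoords (triOfUpper x) = x := by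
  ext ⟨⟨i, j⟩, h⟩
  simp only at h
  simp [upperCoords, triOfUpper, h]

@[simp] theorem upperCoords_symmOfUpper (x : UpperIdx m → ℝ) :
    upperCoords (symmOfUpper x) = x := by
  ext ⟨⟨i, j⟩, h⟩
  simp only at h
  simp [upperCoords, symmOfUpper, h]

theorem triOfUpper_isUpperTriangular (x : UpperIdx m → ℝ) : (triOfUpper x).IsUpperTriangular :=
  fun i j hij => by
    have : ¬ i ≤ j := not_le.mpr hij
    simp [triOfUpper, this]

theorem triOfUpper_diag (x : UpperIdx m → ℝ) (i : Fin m) : triOfUpper x i i = x (diagIdx i) := by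
  simp [triOfUpper, diagIdx]

theorem triOfUpper_upperCoords {A : Matrix (Fin m) (Fin m) ℝ} (hA : A.IsUpperTriangular) :
    triOfUpper (upperCoords A) = A := by
  ext i j
  by_cases h : i ≤ j
  · simp [triOfUpper, upperCoords, h]
  · simp [triOfUpper, h, hA (not_le.mp h)]

theorem symmOfUpper_upperCoords {A : Matrix (Fin m) (Fin m) ℝ} (hA : A.IsSymm) :
    symmOfUpper (upperCoords A) = A := by
  ext i j
  by_cases h : i ≤ j
  · simp [symmOfUpper, upperCoords, h]
  · simpa [symmOfUpper, upperCoords, h] using hA.apply i j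

theorem symmOfUpper_isSymm (x : UpperIdx m → ℝ) : (symmOfUpper x).IsSymm := by
  refine Matrix.IsSymm.ext fun i j => ?_
  rcases lt_trichotomy i j with h | h | h
  · simp [symmOfUpper, h.le, not_le.mpr h]
  · simp [h]
  · simp [symmOfUpper, h.le, not_le.mpr h]

/-- The coordinate vectors of upper triangular matrices with positive diagonal. -/
def posDiag (m : ℕ) : Set (UpperIdx m → ℝ) := {x | ∀ i, 0 < x (diagIdx i)}

theorem measurableSet_posDiag (m : ℕ) : MeasurableSet (posDiag m) := by
  have : posDiag m = ⋂ i, {x | 0 < x (diagIdx i)} := by ext; simp [posDiag]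
  rw [this]
  exact MeasurableSet.iInter fun i => measurableSet_lt measurable_const (measurable_pi_apply _)

open Classical in
/-- The element of `UpperPos m` with the given coordinates (and `1` if the diagonal coordinates are
not all positive). -/
noncomputable def UpperPos.ofCoords (x : UpperIdx m → ℝ) : UpperPos m :=
  if h : x ∈ posDiag m then
    ⟨triOfUpper x, triOfUpper_isUpperTriangular x, fun i => (triOfUpper_diag x i).symm ▸ h i⟩
  else 1

theorem UpperPos.val_ofCoords {x : UpperIdx m → ℝ} (h : x ∈ posDiag m) :
    (UpperPos.ofCoords x).1 = triOfUpper x := congrArg Subtype.val (dif_pos h)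

theorem UpperPos.ofCoords_diag {x : UpperIdx m → ℝ} (h : x ∈ posDiag m) (i : Fin m) :
    (UpperPos.ofCoords x).1 i i = x (diagIdx i) := by
  rw [val_ofCoords h, triOfUpper_diag]

theorem UpperPos.upperCoords_ofCoords {x : UpperIdx m → ℝ} (h : x ∈ posDiag m) :
    upperCoords (UpperPos.ofCoords x).1 = x := by
  rw [val_ofCoords h, upperCoords_triOfUpper]

theorem UpperPos.measurable_ofCoords : Measurable (UpperPos.ofCoords (m := m)) := by
  classical
  have h1 : Measurable fun x : UpperIdx m → ℝ => (UpperPos.ofCoords x).1 := by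
    have : (fun x : UpperIdx m → ℝ => (UpperPos.ofCoords x).1) =
        fun x => if x ∈ posDiag m then triOfUpper x else 1 := by
      ext1 x
      by_cases h : x ∈ posDiag m
      · rw [if_pos h, val_ofCoords h]
      · rw [if_neg h]
        exact congrArg Subtype.val (dif_neg h)
    rw [this]
    exact Measurable.ite (measurableSet_posDiag m) measurable_triOfUpper measurable_const
  exact h1.subtype_mk (h := fun x => (UpperPos.ofCoords x).2)

@[to_additive]
theorem prod_upperIdx {R : Type*} [CommMonoid R] (f : Fin m → Fin m → R) :
    ∏ p : UpperIdx m, f p.1.1 p.1.2 = ∏ i, ∏ j, if i ≤ j then f i j else 1 := by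
  rw [← Finset.prod_subtype (Finset.univ.filter fun p : Fin m × Fin m => p.1 ≤ p.2) (by simp)
    (fun p => f p.1 p.2), Finset.prod_filter, Fintype.prod_prod_type]

/-! ### Determinants of the two linear actions of triangular matrices -/

/-- A matrix which is triangular with respect to a rank function `b` of its indices, and whose only
entries between indices of the same rank are on the diagonal, has as determinant the product of
its diagonal entries. -/
theorem det_eq_prod_diag_of_rank {ι R : Type*} [Fintype ι] [DecidableEq ι] [CommRing R]
    (M : Matrix ι ι R) (b : ι → ℕ) (h : ∀ p q, p ≠ q → b q ≤ b p → M p q = 0) :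
    M.det = ∏ p, M p p := by
  have hM : M.BlockTriangular b := fun p q hpq =>
    h p q (fun e => by simp [e] at hpq) hpq.le
  rw [hM.det, ← Finset.prod_fiberwise_of_maps_to (t := Finset.univ.image b) (g := b)
    (fun p _ => Finset.mem_image_of_mem b (Finset.mem_univ p))]
  refine Finset.prod_congr rfl fun a _ => ?_
  have hdiag : M.toSquareBlock b a = Matrix.diagonal fun p : {p // b p = a} => M p p := by
    ext p q
    by_cases hpq : p = q
    · simp [hpq, Matrix.toSquareBlock_def]
    · rw [Matrix.diagonal_apply_ne _ hpq]
      exact h p q (fun e => hpq (Subtype.ext e)) (q.2.trans p.2.symm).le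
  rw [hdiag, Matrix.det_diagonal]
  exact (Finset.prod_subtype _ (by simp) fun p => M p p).symm

/-- Left multiplication by `L` on upper triangular matrices, in coordinates. -/
def leftMulLin (L : Matrix (Fin m) (Fin m) ℝ) : (UpperIdx m → ℝ) →ₗ[ℝ] (UpperIdx m → ℝ) where
  toFun x := upperCoords (L * triOfUpper x)
  map_add' x y := by
    have : triOfUpper (x + y) = triOfUpper x + triOfUpper y := by
      ext i j; by_cases h : i ≤ j <;> simp [triOfUpper, h]
    rw [this, Matrix.mul_add]; rfl
  map_smul' c x := by
    have : triOfUpper (c • x) = c • triOfUpper x := by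
      ext i j; by_cases h : i ≤ j <;> simp [triOfUpper, h]
    rw [this, Matrix.mul_smul]; rfl

/-- The congruence `A ↦ L A Lᵀ` on symmetric matrices, in coordinates. -/
def conjLin (L : Matrix (Fin m) (Fin m) ℝ) : (UpperIdx m → ℝ) →ₗ[ℝ] (UpperIdx m → ℝ) where
  toFun x := upperCoords (L * symmOfUpper x * Lᵀ)
  map_add' x y := by
    have : symmOfUpper (x + y) = symmOfUpper x + symmOfUpper y := by
      ext i j; by_cases h : i ≤ j <;> simp [symmOfUpper, h]
    rw [this, Matrix.mul_add, Matrix.add_mul]; rfl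
  map_smul' c x := by
    have : symmOfUpper (c • x) = c • symmOfUpper x := by
      ext i j; by_cases h : i ≤ j <;> simp [symmOfUpper, h]
    rw [this, Matrix.mul_smul, Matrix.smul_mul]; rfl

theorem triOfUpper_leftMulLin (L : UpperPos m) (x : UpperIdx m → ℝ) :
    triOfUpper (leftMulLin L.1 x) = L.1 * triOfUpper x :=
  triOfUpper_upperCoords (L.upper.mul (triOfUpper_isUpperTriangular x))

theorem symmOfUpper_conjLin (L : Matrix (Fin m) (Fin m) ℝ) (x : UpperIdx m → ℝ) :
    symmOfUpper (conjLin L x) = L * symmOfUpper x * Lᵀ :=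
  symmOfUpper_upperCoords (A := L * symmOfUpper x * Lᵀ) (by
    rw [Matrix.IsSymm, Matrix.transpose_mul, Matrix.transpose_mul, Matrix.transpose_transpose,
      (symmOfUpper_isSymm x).eq, Matrix.mul_assoc])

theorem det_leftMulLin (L : UpperPos m) :
    LinearMap.det (leftMulLin L.1) = ∏ p : UpperIdx m, L.1 p.1.1 p.1.1 := by
  have hentry : ∀ p q : UpperIdx m, LinearMap.toMatrix' (leftMulLin L.1) p q =
      if q.1.2 = p.1.2 then L.1 p.1.1 q.1.1 else 0 := by
    intro p q
    have h1 : triOfUpper (Pi.single q 1) = Matrix.single q.1.1 q.1.2 1 := by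
      ext i j
      by_cases h : i ≤ j
      · simp only [triOfUpper, Matrix.of_apply, h, dif_pos, Pi.single_apply, Matrix.single_apply]
        exact if_congr ⟨fun e => by simp [← e], fun ⟨e1, e2⟩ => by ext <;> simp [e1, e2]⟩ rfl rfl
      · have : ¬ (q.1.1 = i ∧ q.1.2 = j) := fun ⟨e1, e2⟩ => h (e1 ▸ e2 ▸ q.2)
        simp [triOfUpper, h, this]
    rw [LinearMap.toMatrix'_apply]
    change (L.1 * triOfUpper (Pi.single q 1)) p.1.1 p.1.2 = _
    rw [h1]
    by_cases h : q.1.2 = p.1.2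
    · rw [if_pos h, ← h, Matrix.mul_single_apply_same, mul_one]
    · rw [if_neg h, Matrix.mul_single_apply_of_ne _ _ _ _ _ (Ne.symm h)]
  rw [← LinearMap.det_toMatrix', det_eq_prod_diag_of_rank _ (fun p => (p.1.1 : ℕ) + p.1.2)]
  · exact Finset.prod_congr rfl fun p _ => by rw [hentry, if_pos rfl]
  · intro p q hpq hb
    rw [hentry]
    split_ifs with h
    · refine L.upper (lt_of_le_of_ne ?_ fun e => hpq ?_)
      · rw [h] at hb; simpa using hb
      · exact Subtype.ext (Prod.ext e.symm h.symm)
    · rfl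

theorem det_conjLin (L : UpperPos m) :
    LinearMap.det (conjLin L.1) = L.1.det ^ (m + 1) := by
  have hentry : ∀ p q : UpperIdx m, LinearMap.toMatrix' (conjLin L.1) p q =
      L.1 p.1.1 q.1.1 * L.1 p.1.2 q.1.2 +
        if q.1.1 = q.1.2 then 0 else L.1 p.1.1 q.1.2 * L.1 p.1.2 q.1.1 := by
    intro p q
    have h1 : symmOfUpper (Pi.single q 1) = Matrix.single q.1.1 q.1.2 1 +
        if q.1.1 = q.1.2 then 0 else Matrix.single q.1.2 q.1.1 1 := by
      obtain ⟨⟨a, b⟩, hab⟩ := q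
      simp only at hab
      ext i j
      rcases eq_or_lt_of_le hab with h | h
      · subst h
        by_cases hij : i ≤ j
        · simp [symmOfUpper, hij, Pi.single_apply, Matrix.single_apply, eq_comm]
        · have : ¬ (a = i ∧ a = j) := fun ⟨e1, e2⟩ => hij (e1 ▸ e2.le)
          have h2 : ¬ (j = a ∧ i = a) := fun ⟨e1, e2⟩ => this ⟨e2.symm, e1.symm⟩
          simp [symmOfUpper, hij, Pi.single_apply, this, h2]
      · by_cases hij : i ≤ j
        · have : ¬ (b = i ∧ a = j) := fun ⟨e1, e2⟩ => absurd (e1 ▸ e2 ▸ hij) (not_le.mpr h)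
          simp [symmOfUpper, hij, Pi.single_apply, Matrix.single_apply, h.ne, this, eq_comm]
        · have : ¬ (a = i ∧ b = j) := fun ⟨e1, e2⟩ => hij (e1 ▸ e2 ▸ h.le)
          simp [symmOfUpper, hij, Pi.single_apply, Matrix.single_apply, h.ne, this, eq_comm,
            and_comm]
    have h2 : ∀ a b i j, (L.1 * Matrix.single a b (1 : ℝ) * L.1ᵀ) i j = L.1 i a * L.1 j b := by
      intro a b i j
      rw [Matrix.mul_apply, Finset.sum_eq_single b]
      · rw [Matrix.mul_single_apply_same, mul_one, Matrix.transpose_apply]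
      · intro k _ hk
        rw [Matrix.mul_single_apply_of_ne _ _ _ _ _ hk, zero_mul]
      · simp
    rw [LinearMap.toMatrix'_apply]
    change (L.1 * symmOfUpper (Pi.single q 1) * L.1ᵀ) p.1.1 p.1.2 = _
    rw [h1, Matrix.mul_add, Matrix.add_mul, Matrix.add_apply, h2]
    split_ifs
    · simp
    · rw [h2]
  rw [← LinearMap.det_toMatrix', det_eq_prod_diag_of_rank _ (fun p => (p.1.1 : ℕ) + p.1.2)]
  · have h1 : ∀ p : UpperIdx m, LinearMap.toMatrix' (conjLin L.1) p p =
        L.1 p.1.1 p.1.1 * L.1 p.1.2 p.1.2 := by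
      intro p
      rw [hentry]
      split_ifs with h
      · rw [add_zero]
      · rw [L.upper (lt_of_le_of_ne p.2 h : p.1.1 < p.1.2), mul_zero, add_zero]
    simp only [h1]
    rw [prod_upperIdx fun i j => L.1 i i * L.1 j j, L.det_eq, pow_succ]
    -- Pair the factor of `i` at the position `(i, j)` with `i > j` with that at `(j, i)`.
    have h2 : (∏ i, L.1 i i) ^ m = (∏ i, ∏ j, if i ≤ j then L.1 i i else 1) *
        ∏ i, ∏ j, if i < j then L.1 j j else 1 := by
      have h3 : (∏ i : Fin m, ∏ j : Fin m, if i < j then L.1 j j else 1) =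
          ∏ i : Fin m, ∏ j : Fin m, if i ≤ j then 1 else L.1 i i := by
        rw [Finset.prod_comm]
        refine Finset.prod_congr rfl fun i _ => Finset.prod_congr rfl fun j _ => ?_
        by_cases h : j < i
        · simp [h]
        · simp [h, not_lt.mp h]
      rw [h3, ← Finset.prod_mul_distrib, ← Finset.prod_pow]
      refine Finset.prod_congr rfl fun i _ => ?_
      rw [← Finset.prod_mul_distrib]
      have : ∀ j : Fin m, ((if i ≤ j then L.1 i i else 1) * if i ≤ j then 1 else L.1 i i) =
          L.1 i i := fun j => by split_ifs <;> simp
      simp [this]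
    have h4 : ∏ i, L.1 i i = ∏ i, ∏ j, if i = j then L.1 j j else 1 :=
      Finset.prod_congr rfl fun i _ => by simp
    rw [h2]
    refine Eq.trans ?_ (congrArg _ h4.symm)
    simp only [← Finset.prod_mul_distrib]
    refine Finset.prod_congr rfl fun i _ => Finset.prod_congr rfl fun j _ => ?_
    rcases lt_trichotomy i j with h | h | h
    · simp [h, h.le, h.ne]
    · simp [h]
    · simp [h.not_gt, not_le.mpr h, h.ne']
  · intro p q hpq hb
    rw [hentry]
    have hp : (p.1.1 : ℕ) ≤ p.1.2 := p.2
    have hq : (q.1.1 : ℕ) ≤ q.1.2 := q.2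
    have hne : ¬ ((p.1.1 : ℕ) = q.1.1 ∧ (p.1.2 : ℕ) = q.1.2) := fun ⟨e1, e2⟩ =>
      hpq (Subtype.ext (Prod.ext (Fin.ext e1) (Fin.ext e2)))
    have hz : ∀ a b : Fin m, (b : ℕ) < a → L.1 a b = 0 := fun a b hab => L.upper hab
    have e1 : L.1 p.1.1 q.1.1 * L.1 p.1.2 q.1.2 = 0 := by
      by_cases h : (q.1.1 : ℕ) < p.1.1
      · rw [hz _ _ h, zero_mul]
      · rw [hz p.1.2 q.1.2 (by omega), mul_zero]
    have e2 : L.1 p.1.1 q.1.2 * L.1 p.1.2 q.1.1 = 0 := by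
      by_cases h : (q.1.2 : ℕ) < p.1.1
      · rw [hz _ _ h, zero_mul]
      · rw [hz p.1.2 q.1.1 (by omega), mul_zero]
    rw [e1, e2, ite_self, add_zero]

/-! ### Invariant measures and densities -/

open scoped ENNReal

theorem map_withDensity_comp {α β : Type*} [MeasurableSpace α] [MeasurableSpace β]
    (μ : Measure α) {f : α → β} (hf : Measurable f) {g : β → ℝ≥0∞} (hg : Measurable g) :
    (μ.withDensity fun x => g (f x)).map f = (μ.map f).withDensity g := by
  ext s hs
  rw [Measure.map_apply hf hs, withDensity_apply _ (hf hs), withDensity_apply _ hs,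
    setLIntegral_map hs hg hf]

/-- Let a group act on a measure space by maps `M L` which scale the measure `μ` by `(c L)⁻¹`, and
let `κ` be an equivariant map to the group. If the density `d` transforms with the factor `c L`,
then the image of `d μ` under `κ` is left invariant. -/
theorem isMulLeftInvariant_map_withDensity {E G : Type*} [MeasurableSpace E] [MeasurableSpace G]
    [Group G] [MeasurableMul G] (μ : Measure E) {κ : E → G} (hκ : Measurable κ) {d : E → ℝ≥0∞}
    (hd : Measurable d) (M : G → E → E) (hM : ∀ L, Measurable (M L)) (c : G → ℝ≥0∞)
    (hc0 : ∀ L, c L ≠ 0) (hc : ∀ L, c L ≠ ∞) (hμ : ∀ L, μ.map (M L) = (c L)⁻¹ • μ)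
    (hdM : ∀ L x, d x = c L * d (M L x)) (hκM : ∀ L x, d x ≠ 0 → κ (M L x) = L * κ x) :
    ((μ.withDensity d).map κ).IsMulLeftInvariant := by
  refine ⟨fun L => ?_⟩
  rw [Measure.map_map (measurable_const_mul L) hκ]
  ext B hB
  have hm : Measurable fun x => (κ ⁻¹' B).indicator d x := hd.indicator (hκ hB)
  have h1 : ∀ x, ((fun x => L * κ x) ⁻¹' B).indicator d x =
      c L * (κ ⁻¹' B).indicator d (M L x) := by
    intro x
    by_cases hx : d x = 0
    · have h2 : d (M L x) = 0 := by
        have := hdM L x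
        rw [hx] at this
        exact (mul_eq_zero.mp this.symm).resolve_left (hc0 L)
      rw [Set.indicator_apply_eq_zero.mpr fun _ => hx, Set.indicator_apply_eq_zero.mpr fun _ => h2,
        mul_zero]
    · by_cases hB' : L * κ x ∈ B
      · have h2 : M L x ∈ κ ⁻¹' B := by rwa [Set.mem_preimage, hκM L x hx]
        rw [Set.indicator_of_mem h2, Set.indicator_of_mem (by exact hB'), hdM L x]
      · have h2 : M L x ∉ κ ⁻¹' B := by rwa [Set.mem_preimage, hκM L x hx]
        rw [Set.indicator_of_notMem h2, Set.indicator_of_notMem (by exact hB'), mul_zero]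
  have hLκ : Measurable fun x => L * κ x := hκ.const_mul L
  rw [Measure.map_apply (by exact hLκ) hB, Measure.map_apply hκ hB,
    withDensity_apply _ (by exact hLκ hB), withDensity_apply _ (hκ hB),
    ← lintegral_indicator (by exact hLκ hB), ← lintegral_indicator (hκ hB)]
  calc ∫⁻ x, ((fun x => L * κ x) ⁻¹' B).indicator d x ∂μ
      = c L * ∫⁻ x, (κ ⁻¹' B).indicator d (M L x) ∂μ := by
        simp only [h1]
        exact lintegral_const_mul _ (hm.comp (hM L))
    _ = ∫⁻ x, (κ ⁻¹' B).indicator d x ∂μ := by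
        rw [← lintegral_map hm (hM L), hμ, lintegral_smul_measure, smul_eq_mul, ← mul_assoc,
          ENNReal.mul_inv_cancel (hc0 L) (hc L), one_mul]

/-- Uniqueness of σ-finite left invariant measures up to a finite factor. -/
theorem exists_eq_smul_of_isMulLeftInvariant {G : Type*} [MeasurableSpace G] [Group G]
    [MeasurableMul₂ G] [MeasurableInv G] (μ ν : Measure G) [SigmaFinite μ] [SigmaFinite ν]
    [μ.IsMulLeftInvariant] [ν.IsMulLeftInvariant] (hν : ν ≠ 0) :
    ∃ c : ℝ≥0∞, c ≠ ∞ ∧ μ = c • ν := by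
  obtain ⟨k, hk⟩ : ∃ k, ν (spanningSets (μ + ν) k) ≠ 0 := by
    by_contra! h
    refine hν (Measure.measure_univ_eq_zero.mp ?_)
    rw [← iUnion_spanningSets (μ + ν)]
    exact measure_iUnion_null h
  have hfin := measure_spanningSets_lt_top (μ + ν) k
  rw [Measure.add_apply] at hfin
  have h1 := (ENNReal.add_lt_top.mp hfin).1
  have h2 := (ENNReal.add_lt_top.mp hfin).2
  exact ⟨_, (ENNReal.div_lt_top h1.ne hk).ne, measure_eq_div_smul μ ν hk h2.ne⟩

/-- Translating the density `h` with respect to a left invariant measure. -/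
theorem map_mul_left_withDensity {G : Type*} [MeasurableSpace G] [Group G] [MeasurableMul G]
    (ν : Measure G) [ν.IsMulLeftInvariant] {h : G → ℝ≥0∞} (hh : Measurable h) (V : G) :
    (ν.withDensity h).map (V * ·) = ν.withDensity fun Z => h (V⁻¹ * Z) := by
  have h1 := map_withDensity_comp ν (measurable_const_mul V)
    (g := fun Z => h (V⁻¹ * Z)) (hh.comp (measurable_const_mul _))
  rw [map_mul_left_eq_self ν V] at h1
  rw [← h1]
  simp only [inv_mul_cancel_left]

theorem eq_of_eq_smul_of_isProbabilityMeasure {α : Type*} [MeasurableSpace α]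
    {μ ν ρ : Measure α} [IsProbabilityMeasure μ] [IsProbabilityMeasure ν] {a b : ℝ≥0∞}
    (hμ : μ = a • ρ) (hν : ν = b • ρ) : μ = ν := by
  have h1 : a * ρ Set.univ = 1 := by
    rw [← smul_eq_mul, ← Measure.smul_apply, ← hμ, measure_univ]
  have h2 : b * ρ Set.univ = 1 := by
    rw [← smul_eq_mul, ← Measure.smul_apply, ← hν, measure_univ]
  have : a = b := (ENNReal.eq_inv_of_mul_eq_one_left h1).trans
    (ENNReal.eq_inv_of_mul_eq_one_left h2).symm
  rw [hμ, hν, this]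

/-- A product of finite measures with densities has the product density. -/
theorem pi_withDensity_ofReal {ι : Type*} [Fintype ι] {X : ι → Type*}
    [∀ i, MeasureSpace (X i)] [∀ i, SigmaFinite (volume : Measure (X i))] {f : ∀ i, X i → ℝ}
    (hf : ∀ i, Measurable (f i)) (hf0 : ∀ i x, 0 ≤ f i x)
    (hfin : ∀ i, ∫⁻ x, ENNReal.ofReal (f i x) ≠ ∞) :
    Measure.pi (fun i => (volume : Measure (X i)).withDensity fun x => ENNReal.ofReal (f i x)) =
      volume.withDensity fun x : ∀ i, X i => ENNReal.ofReal (∏ i, f i (x i)) := by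
  have hint : ∀ i, Integrable (f i) volume := fun i =>
    ⟨(hf i).aestronglyMeasurable, (hasFiniteIntegral_iff_ofReal (ae_of_all _ (hf0 i))).mpr
      (hfin i).lt_top⟩
  refine Measure.pi_eq fun s hs => ?_
  have hbox : MeasurableSet (Set.univ.pi s) := MeasurableSet.univ_pi hs
  have hi : ∀ i, Integrable ((s i).indicator (f i)) volume := fun i => (hint i).indicator (hs i)
  have hi0 : ∀ i x, 0 ≤ (s i).indicator (f i) x := fun i x =>
    Set.indicator_nonneg (fun x _ => hf0 i x) x
  rw [withDensity_apply _ hbox, ← lintegral_indicator hbox]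
  have h1 : ∀ x : ∀ i, X i, (Set.univ.pi s).indicator
      (fun x => ENNReal.ofReal (∏ i, f i (x i))) x =
      ENNReal.ofReal (∏ i, (s i).indicator (f i) (x i)) := by
    intro x
    by_cases hx : x ∈ Set.univ.pi s
    · rw [Set.indicator_of_mem hx]
      congr 1
      exact Finset.prod_congr rfl fun i _ => by
        rw [Set.indicator_of_mem (hx i (Set.mem_univ i))]
    · rw [Set.indicator_of_notMem hx]
      obtain ⟨i, hi⟩ : ∃ i, x i ∉ s i := by simpa [Set.mem_pi] using hx
      rw [Finset.prod_eq_zero (Finset.mem_univ i) (Set.indicator_of_notMem hi _),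
        ENNReal.ofReal_zero]
  simp only [h1]
  rw [volume_pi, ← ofReal_integral_eq_lintegral_ofReal (Integrable.fintype_prod_dep hi)
    (ae_of_all _ fun x => Finset.prod_nonneg fun i _ => hi0 i _),
    integral_fintype_prod_eq_prod, ENNReal.ofReal_prod_of_nonneg
      fun i _ => integral_nonneg (hi0 i)]
  refine Finset.prod_congr rfl fun i _ => ?_
  rw [withDensity_apply _ (hs i), ← lintegral_indicator (hs i),
    ofReal_integral_eq_lintegral_ofReal (hi i) (ae_of_all _ (hi0 i))]
  refine lintegral_congr fun x => ?_
  by_cases hx : x ∈ s i <;> simp [hx]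

/-! ### The laws of the entries of the Bartlett factor -/

/-- The density of the `χ` distribution. -/
noncomputable def chiPDFReal (k x : ℝ) : ℝ :=
  if 0 < x then 2 ^ (1 - k / 2) / Real.Gamma (k / 2) * x ^ (k - 1) * Real.exp (-x ^ 2 / 2) else 0

theorem chi_eq (k : ℝ) : chi k = volume.withDensity fun x => ENNReal.ofReal (chiPDFReal k x) := rfl

theorem chiPDFReal_nonneg {k : ℝ} (hk : 0 < k) (x : ℝ) : 0 ≤ chiPDFReal k x := by
  rw [chiPDFReal]
  split_ifs with h
  · have := Real.Gamma_pos_of_pos (half_pos hk)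
    positivity
  · exact le_rfl

theorem measurable_chiPDFReal (k : ℝ) : Measurable (chiPDFReal k) := by
  unfold chiPDFReal
  refine Measurable.ite measurableSet_Ioi ?_ measurable_const
  fun_prop

theorem isProbabilityMeasure_chi {k : ℝ} (hk : 0 < k) : IsProbabilityMeasure (chi k) := by
  constructor
  have hG := Real.Gamma_pos_of_pos (half_pos hk)
  set C : ℝ := 2 ^ (1 - k / 2) / Real.Gamma (k / 2) with hC
  have hfun : ∀ x, chiPDFReal k x = (Set.Ioi (0 : ℝ)).indicator
      (fun x => C * (x ^ (k - 1) * Real.exp (-(1 / 2) * x ^ (2 : ℝ)))) x := by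
    intro x
    by_cases hx : 0 < x
    · rw [Set.indicator_of_mem (by exact hx), chiPDFReal, if_pos hx, mul_assoc, Real.rpow_two,
        show -x ^ 2 / 2 = -(1 / 2) * x ^ 2 by ring]
    · rw [Set.indicator_of_notMem (by exact hx), chiPDFReal, if_neg hx]
  have hint := integrableOn_rpow_mul_exp_neg_mul_rpow (s := k - 1) (p := 2) (b := 1 / 2)
    (by linarith) two_pos (by norm_num)
  rw [chi_eq, withDensity_apply _ MeasurableSet.univ, setLIntegral_univ,
    ← ofReal_integral_eq_lintegral_ofReal _ (ae_of_all _ (chiPDFReal_nonneg hk))]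
  · simp only [hfun]
    rw [integral_indicator measurableSet_Ioi, integral_const_mul,
      integral_rpow_mul_exp_neg_mul_rpow two_pos (by linarith) (by norm_num)]
    rw [ENNReal.ofReal_eq_one, hC]
    have h2 : (1 / 2 : ℝ) ^ (-(k - 1 + 1) / 2) = 2 ^ (k / 2) := by
      rw [one_div, Real.inv_rpow two_pos.le, ← Real.rpow_neg two_pos.le]
      congr 1; ring
    have h3 : (2 : ℝ) ^ (1 - k / 2) * 2 ^ (k / 2) = 2 := by
      rw [← Real.rpow_add two_pos]; norm_num
    rw [h2, sub_add_cancel]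
    calc (2 : ℝ) ^ (1 - k / 2) / Real.Gamma (k / 2) *
          (2 ^ (k / 2) * (1 / 2) * Real.Gamma (k / 2))
        = (2 ^ (1 - k / 2) * 2 ^ (k / 2)) * (1 / 2) *
          (Real.Gamma (k / 2) / Real.Gamma (k / 2)) := by ring
      _ = 1 := by rw [h3, div_self hG.ne']; norm_num
  · rw [funext hfun]
    exact (integrable_indicator_iff measurableSet_Ioi).mpr (hint.const_mul C)

/-- The density of the entry at position `p` of the Bartlett factor. -/
noncomputable def entryPDFReal (n : ℝ) (p : UpperIdx m) (t : ℝ) : ℝ :=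
  if p.1.1 = p.1.2 then chiPDFReal (n - m + (p.1.2.val + 1)) t else gaussianPDFReal 0 1 t

/-- The law of the entry at position `p` of the Bartlett factor: `χ` on the diagonal, and standard
normal above it. -/
noncomputable def entryLaw (n : ℝ) (p : UpperIdx m) : Measure ℝ :=
  if p.1.1 = p.1.2 then chi (n - m + (p.1.2.val + 1)) else gaussianReal 0 1

theorem entryLaw_eq (n : ℝ) (p : UpperIdx m) :
    entryLaw n p = volume.withDensity fun t => ENNReal.ofReal (entryPDFReal n p t) := by
  unfold entryLaw entryPDFReal
  split_ifs
  · rw [chi_eq]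
  · rw [gaussianReal_of_var_ne_zero _ one_ne_zero]; rfl

theorem degree_pos {n : ℝ} (hn : (m : ℝ) - 1 < n) (i : Fin m) :
    0 < n - m + (i.val + 1 : ℝ) := by
  have : (0 : ℝ) ≤ i.val := Nat.cast_nonneg _
  linarith

theorem isProbabilityMeasure_entryLaw {n : ℝ} (hn : (m : ℝ) - 1 < n) (p : UpperIdx m) :
    IsProbabilityMeasure (entryLaw n p) := by
  unfold entryLaw
  split_ifs
  · exact isProbabilityMeasure_chi (degree_pos hn _)
  · infer_instance

/-- The joint law of the entries on and above the diagonal of the Bartlett factor. -/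
noncomputable def entriesLaw (m : ℕ) (n : ℝ) : Measure (UpperIdx m → ℝ) :=
  Measure.pi fun p => entryLaw n p

theorem isProbabilityMeasure_entriesLaw {n : ℝ} (hn : (m : ℝ) - 1 < n) :
    IsProbabilityMeasure (entriesLaw m n) := by
  have := isProbabilityMeasure_entryLaw (m := m) hn
  unfold entriesLaw
  infer_instance

theorem entriesLaw_eq {n : ℝ} (hn : (m : ℝ) - 1 < n) :
    entriesLaw m n = volume.withDensity fun x =>
      ENNReal.ofReal (∏ p, entryPDFReal n p (x p)) := by
  have := isProbabilityMeasure_entryLaw (m := m) hn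
  unfold entriesLaw
  simp only [entryLaw_eq]
  refine pi_withDensity_ofReal (fun p => ?_) (fun p t => ?_) fun p => ?_
  · unfold entryPDFReal
    split_ifs
    · exact measurable_chiPDFReal _
    · exact measurable_gaussianPDFReal _ _
  · unfold entryPDFReal
    split_ifs
    · exact chiPDFReal_nonneg (degree_pos hn _) t
    · exact gaussianPDFReal_nonneg _ _ _
  · rw [← setLIntegral_univ, ← withDensity_apply _ MeasurableSet.univ, ← entryLaw_eq, measure_univ]
    exact ENNReal.one_ne_top

/-- The product of the densities of the entries `x` of the Bartlett factor `Z`, up to a constant, is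
`exp(-tr(Z Zᵀ) / 2) (det Z) ^ n` divided by the Jacobian determinant `∏ p, x (diagIdx p.1.1)` of
the left multiplication by `Z`. -/
theorem exists_prod_entryPDFReal {n : ℝ} (hn : (m : ℝ) - 1 < n) : ∃ C : ℝ, 0 < C ∧
    ∀ x : UpperIdx m → ℝ, ∏ p, entryPDFReal n p (x p) = C * (posDiag m).indicator (fun x =>
      (∏ p : UpperIdx m, (x (diagIdx p.1.1))⁻¹) *
        (Real.exp (-(1 / 2) * ∑ p, x p ^ 2) * (∏ i, x (diagIdx i)) ^ n)) x := by
  let c : UpperIdx m → ℝ := fun p => if p.1.1 = p.1.2 then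
    2 ^ (1 - (n - m + (p.1.2.val + 1)) / 2) / Real.Gamma ((n - m + (p.1.2.val + 1)) / 2)
    else (√(2 * Real.pi))⁻¹
  let r : Fin m → ℝ → ℝ := fun i t => if 0 < t then t ^ (n - m + i.val) else 0
  have hpdf : ∀ p t, entryPDFReal n p t =
      c p * Real.exp (-(1 / 2) * t ^ 2) * if p.1.1 = p.1.2 then r p.1.1 t else 1 := by
    intro p t
    unfold entryPDFReal
    simp only [c, r]
    split_ifs with h h1
    · rw [chiPDFReal, if_pos h1, h, show n - m + (p.1.2.val + 1 : ℝ) - 1 = n - m + p.1.2.val by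
        ring, show -(1 / 2) * t ^ 2 = -t ^ 2 / 2 by ring]
      ring
    · rw [chiPDFReal, if_neg h1, mul_zero]
    · rw [gaussianPDFReal]
      simp only [NNReal.coe_one, mul_one, sub_zero]
      rw [show -(1 / 2) * t ^ 2 = -t ^ 2 / 2 by ring]
  refine ⟨∏ p, c p, Finset.prod_pos fun p _ => ?_, fun x => ?_⟩
  · simp only [c]
    split_ifs
    · have := Real.Gamma_pos_of_pos (half_pos (degree_pos hn p.1.2))
      positivity
    · positivity
  simp only [hpdf, Finset.prod_mul_distrib]
  rw [← Real.exp_sum, ← Finset.mul_sum, mul_assoc]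
  congr 1
  have hdiag : (∏ p : UpperIdx m, if p.1.1 = p.1.2 then r p.1.1 (x p) else 1) =
      ∏ i, r i (x (diagIdx i)) := by
    have h1 : ∀ p : UpperIdx m, (if p.1.1 = p.1.2 then r p.1.1 (x p) else 1) =
        if p.1.1 = p.1.2 then r p.1.1 (x (diagIdx p.1.1)) else 1 := by
      rintro ⟨⟨i, j⟩, hij⟩
      by_cases h : i = j
      · subst h; rfl
      · simp [h]
    simp only [h1]
    rw [prod_upperIdx fun i j => if i = j then r i (x (diagIdx i)) else 1]
    refine Finset.prod_congr rfl fun i _ => ?_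
    rw [Finset.prod_eq_single i]
    · simp
    · intro j _ hj
      simp [Ne.symm hj]
    · simp
  rw [hdiag]
  by_cases hx : x ∈ posDiag m
  · rw [Set.indicator_of_mem hx]
    have h2 : ∏ i, r i (x (diagIdx i)) =
        (∏ p : UpperIdx m, (x (diagIdx p.1.1))⁻¹) * (∏ i, x (diagIdx i)) ^ n := by
      rw [prod_upperIdx fun i j => (x (diagIdx i))⁻¹,
        ← Real.finsetProd_rpow _ _ fun i _ => (hx i).le, ← Finset.prod_mul_distrib]
      refine Finset.prod_congr rfl fun i _ => ?_
      have h3 : (∏ j : Fin m, if i ≤ j then (x (diagIdx i))⁻¹ else 1) =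
          x (diagIdx i) ^ (-((m : ℝ) - i.val)) := by
        rw [← Finset.prod_filter, Finset.prod_const]
        have : (Finset.univ.filter fun j => i ≤ j).card = m - i.val := by
          rw [← Fin.card_Ici]
          congr 1
          ext j; simp
        rw [this, Real.rpow_neg (hx i).le, ← Nat.cast_sub i.2.le, Real.rpow_natCast, inv_pow]
      rw [h3, ← Real.rpow_add (hx i)]
      simp only [r]
      rw [if_pos (hx i)]
      congr 1; ring
    rw [h2]; ring
  · rw [Set.indicator_of_notMem hx]
    obtain ⟨i, hi⟩ : ∃ i, ¬ 0 < x (diagIdx i) := by simpa [posDiag] using hx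
    rw [Finset.prod_eq_zero (Finset.mem_univ i) (by simp only [r]; rw [if_neg hi]), mul_zero]

/-! ### Left Haar measure on triangular matrices and the law of the Bartlett factor -/

theorem ofReal_abs_inv {a : ℝ} (ha : 0 < a) :
    ENNReal.ofReal |a⁻¹| = (ENNReal.ofReal a)⁻¹ := by
  rw [abs_of_pos (inv_pos.mpr ha), ENNReal.ofReal_inv_of_pos ha]

/-- The density of left Haar measure on `UpperPos m` with respect to Lebesgue measure. -/
noncomputable def haarDensity (m : ℕ) : (UpperIdx m → ℝ) → ℝ≥0∞ :=
  (posDiag m).indicator fun x => ENNReal.ofReal (∏ p : UpperIdx m, (x (diagIdx p.1.1))⁻¹)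

/-- Left Haar measure on `UpperPos m`. -/
noncomputable def haarUpper (m : ℕ) : Measure (UpperPos m) :=
  (volume.withDensity (haarDensity m)).map UpperPos.ofCoords

theorem measurable_haarDensity : Measurable (haarDensity m) := by
  refine Measurable.indicator ?_ (measurableSet_posDiag m)
  exact Measurable.ennreal_ofReal (by fun_prop)

theorem haarDensity_ne_zero {x : UpperIdx m → ℝ} (hx : haarDensity m x ≠ 0) : x ∈ posDiag m :=
  Set.mem_of_indicator_ne_zero hx

theorem haarDensity_ne_top (x : UpperIdx m → ℝ) : haarDensity m x ≠ ∞ := by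
  by_cases hx : x ∈ posDiag m <;> simp [haarDensity, hx]

theorem leftMulLin_diag (L : UpperPos m) (x : UpperIdx m → ℝ) (i : Fin m) :
    leftMulLin L.1 x (diagIdx i) = L.1 i i * x (diagIdx i) := by
  rw [← triOfUpper_diag x]
  exact diag_mul_of_isUpperTriangular L.upper (triOfUpper_isUpperTriangular x) i

theorem leftMulLin_mem_posDiag (L : UpperPos m) (x : UpperIdx m → ℝ) :
    leftMulLin L.1 x ∈ posDiag m ↔ x ∈ posDiag m := by
  simp only [posDiag, Set.mem_ofPred_eq, leftMulLin_diag]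
  exact forall_congr' fun i => mul_pos_iff_of_pos_left (L.diag_pos i)

instance : (haarUpper m).IsMulLeftInvariant := by
  have hpos : ∀ L : UpperPos m, 0 < ∏ p : UpperIdx m, L.1 p.1.1 p.1.1 := fun L =>
    Finset.prod_pos fun p _ => L.diag_pos _
  refine isMulLeftInvariant_map_withDensity volume UpperPos.measurable_ofCoords
    measurable_haarDensity (fun L => leftMulLin L.1)
    (fun L => (leftMulLin L.1).continuous_of_finiteDimensional.measurable)
    (fun L => ENNReal.ofReal (∏ p : UpperIdx m, L.1 p.1.1 p.1.1))
    (fun L => by simpa using hpos L) (fun L => ENNReal.ofReal_ne_top) (fun L => ?_)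
    (fun L x => ?_) fun L x hx => ?_
  · rw [Measure.map_linearMap_addHaar_eq_smul_addHaar _
      (by rw [det_leftMulLin]; exact (hpos L).ne'), det_leftMulLin, ofReal_abs_inv (hpos L)]
  · by_cases hx : x ∈ posDiag m
    · rw [haarDensity, Set.indicator_of_mem hx,
        Set.indicator_of_mem ((leftMulLin_mem_posDiag L x).mpr hx),
        ← ENNReal.ofReal_mul (hpos L).le, ← Finset.prod_mul_distrib]
      congr 1
      refine Finset.prod_congr rfl fun p _ => ?_
      rw [leftMulLin_diag, mul_inv, mul_inv_cancel_left₀ (L.diag_pos _).ne']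
    · rw [haarDensity, Set.indicator_of_notMem hx,
        Set.indicator_of_notMem (mt (leftMulLin_mem_posDiag L x).mp hx), mul_zero]
  · have hx' := haarDensity_ne_zero hx
    refine Subtype.ext ?_
    rw [UpperPos.val_ofCoords ((leftMulLin_mem_posDiag L x).mpr hx'), triOfUpper_leftMulLin,
      UpperPos.val_mul, UpperPos.val_ofCoords hx']

instance : SigmaFinite (haarUpper m) := by
  have hm : Measurable fun Z : UpperPos m => upperCoords Z.1 :=
    measurable_upperCoords.comp UpperPos.measurable_val
  refine SigmaFinite.of_map _ hm.aemeasurable ?_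
  have h1 : (haarUpper m).map (fun Z => upperCoords Z.1) = volume.withDensity (haarDensity m) := by
    rw [haarUpper, Measure.map_map hm UpperPos.measurable_ofCoords]
    refine (Measure.map_congr ?_).trans Measure.map_id
    rw [Filter.EventuallyEq, ae_withDensity_iff measurable_haarDensity]
    exact ae_of_all _ fun x hx => UpperPos.upperCoords_ofCoords (haarDensity_ne_zero hx)
  rw [h1]
  exact SigmaFinite.withDensity_of_ne_top' haarDensity_ne_top

/-- The density, up to a constant, of the law of the Bartlett factor with respect to left Haar
measure. -/
noncomputable def bartlettWeight (n : ℝ) (Z : UpperPos m) : ℝ≥0∞ :=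
  ENNReal.ofReal (Real.exp (-(1 / 2) * Z.gram.trace) * Z.1.det ^ n)

/-- The law of the Bartlett factor: the entries are independent, standard normal above the diagonal
and `χ` on the diagonal. -/
noncomputable def bartlettLaw (m : ℕ) (n : ℝ) : Measure (UpperPos m) :=
  (entriesLaw m n).map UpperPos.ofCoords

theorem measurable_bartlettWeight (n : ℝ) : Measurable (bartlettWeight (m := m) n) := by
  have h1 : Measurable fun Z : UpperPos m => Z.gram.trace :=
    (continuous_id.matrix_trace.measurable).comp UpperPos.measurable_gram
  have h2 : Measurable fun Z : UpperPos m => Z.1.det :=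
    measurable_matrix_det.comp UpperPos.measurable_val
  unfold bartlettWeight
  fun_prop

theorem trace_gram (Z : UpperPos m) : Z.gram.trace = ∑ p, upperCoords Z.1 p ^ 2 := by
  simp only [upperCoords]
  rw [sum_upperIdx fun i j => Z.1 i j ^ 2]
  simp only [UpperPos.gram, Matrix.trace, Matrix.diag, Matrix.mul_apply, Matrix.transpose_apply]
  refine Finset.sum_congr rfl fun i _ => Finset.sum_congr rfl fun j _ => ?_
  by_cases h : i ≤ j
  · rw [if_pos h, sq]
  · rw [if_neg h, Z.upper (not_le.mp h), zero_mul]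

theorem isProbabilityMeasure_bartlettLaw {n : ℝ} (hn : (m : ℝ) - 1 < n) :
    IsProbabilityMeasure (bartlettLaw m n) := by
  have := isProbabilityMeasure_entriesLaw hn
  exact Measure.isProbabilityMeasure_map UpperPos.measurable_ofCoords.aemeasurable

theorem ae_entriesLaw_mem_posDiag {n : ℝ} (hn : (m : ℝ) - 1 < n) :
    ∀ᵐ x ∂entriesLaw m n, x ∈ posDiag m := by
  obtain ⟨C, -, h⟩ := exists_prod_entryPDFReal hn
  have : (entriesLaw m n) (posDiag m)ᶜ = 0 := by
    rw [entriesLaw_eq hn, withDensity_apply _ (measurableSet_posDiag m).compl,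
      setLIntegral_congr_fun (g := 0) (measurableSet_posDiag m).compl]
    · simp
    · intro x hx
      simp only [h, Set.indicator_of_notMem hx, mul_zero, ENNReal.ofReal_zero, Pi.zero_apply]
  exact this

theorem exists_bartlettLaw_eq {n : ℝ} (hn : (m : ℝ) - 1 < n) : ∃ C : ℝ≥0∞, C ≠ 0 ∧ C ≠ ∞ ∧
    bartlettLaw m n = C • (haarUpper m).withDensity (bartlettWeight n) := by
  obtain ⟨C, hC, h⟩ := exists_prod_entryPDFReal hn
  refine ⟨ENNReal.ofReal C, by simpa using hC, ENNReal.ofReal_ne_top, ?_⟩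
  have hm : Measurable fun x : UpperIdx m → ℝ => bartlettWeight n (UpperPos.ofCoords x) :=
    (measurable_bartlettWeight n).comp UpperPos.measurable_ofCoords
  have h1 : entriesLaw m n = ENNReal.ofReal C • (volume.withDensity (haarDensity m)).withDensity
      fun x => bartlettWeight n (UpperPos.ofCoords x) := by
    rw [entriesLaw_eq hn, ← withDensity_mul _ measurable_haarDensity hm,
      ← withDensity_smul _ (measurable_haarDensity.mul hm)]
    congr 1
    ext x
    simp only [h, Pi.smul_apply, Pi.mul_apply, smul_eq_mul]
    rw [ENNReal.ofReal_mul hC.le]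
    congr 1
    by_cases hx : x ∈ posDiag m
    · rw [haarDensity, Set.indicator_of_mem hx, Set.indicator_of_mem hx, bartlettWeight,
        ENNReal.ofReal_mul (Finset.prod_nonneg fun p _ => inv_nonneg.mpr (hx _).le), trace_gram,
        UpperPos.upperCoords_ofCoords hx, UpperPos.det_eq]
      simp only [UpperPos.ofCoords_diag hx]
    · simp [haarDensity, hx]
  rw [bartlettLaw, h1, Measure.map_smul,
    map_withDensity_comp _ UpperPos.measurable_ofCoords (measurable_bartlettWeight n)]
  rfl

theorem haarUpper_ne_zero : haarUpper m ≠ 0 := by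
  -- `m` is a number of degrees of freedom for which the law of the Bartlett factor is defined.
  have hn : (m : ℝ) - 1 < m := by linarith
  obtain ⟨C, -, -, h⟩ := exists_bartlettLaw_eq hn
  have := isProbabilityMeasure_bartlettLaw hn
  intro h0
  rw [h0, withDensity_zero_left, smul_zero] at h
  exact IsProbabilityMeasure.ne_zero _ h

theorem bartlettWeight_inv_mul (n : ℝ) (V Z : UpperPos m) :
    bartlettWeight n (V⁻¹ * Z) = ENNReal.ofReal ((V.1.det ^ n)⁻¹) *
      ENNReal.ofReal (Real.exp (-(1 / 2) * ((V.gram)⁻¹ * Z.gram).trace) * Z.1.det ^ n) := by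
  have htr : (UpperPos.gram (V⁻¹ * Z)).trace = (V.gram⁻¹ * Z.gram).trace := by
    rw [UpperPos.gram_mul, Matrix.trace_mul_comm, ← Matrix.mul_assoc, UpperPos.val_inv,
      Matrix.transpose_nonsing_inv, ← Matrix.mul_inv_rev]
    rfl
  rw [bartlettWeight, htr, UpperPos.val_mul, Matrix.det_mul, UpperPos.val_inv,
    Matrix.det_nonsing_inv, Ring.inverse_eq_inv',
    Real.mul_rpow (inv_nonneg.mpr V.det_pos.le) Z.det_pos.le, Real.inv_rpow V.det_pos.le,
    ← ENNReal.ofReal_mul (inv_nonneg.mpr (Real.rpow_nonneg V.det_pos.le n))]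
  congr 1; ring

/-- The weight of the Bartlett factor, translated by `V`, gives with respect to any σ-finite left
invariant measure a multiple of the law of `V Z`, where `Z` is the Bartlett factor. -/
theorem exists_withDensity_bartlettWeight_eq {n : ℝ} (hn : (m : ℝ) - 1 < n)
    (ρ : Measure (UpperPos m)) [SigmaFinite ρ] [ρ.IsMulLeftInvariant] (V : UpperPos m) :
    ∃ C : ℝ≥0∞, C ≠ ∞ ∧ (ρ.withDensity fun Z => bartlettWeight n (V⁻¹ * Z)) =
      C • (bartlettLaw m n).map (V * ·) := by
  obtain ⟨c, hc, hρ⟩ := exists_eq_smul_of_isMulLeftInvariant ρ (haarUpper m) haarUpper_ne_zero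
  obtain ⟨C, hC0, hC, hb⟩ := exists_bartlettLaw_eq hn
  refine ⟨c * C⁻¹, ENNReal.mul_ne_top hc (ENNReal.inv_ne_top.mpr hC0), ?_⟩
  rw [hb, Measure.map_smul, smul_smul, mul_assoc, ENNReal.inv_mul_cancel hC0 hC, mul_one,
    map_mul_left_withDensity _ (measurable_bartlettWeight n), hρ, withDensity_smul_measure]

/-! ### The Wishart density -/

/-- The positive definite matrices, in coordinates. -/
def posDefCoords (m : ℕ) : Set (UpperIdx m → ℝ) := {x | (symmOfUpper x).PosDef}

theorem measurableSet_posDefCoords (m : ℕ) : MeasurableSet (posDefCoords m) :=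
  measurable_symmOfUpper (UpperPos.measurableSet_posDef m)

/-- The density of the measure `(det A) ^ (-(m + 1) / 2) dA` on positive definite matrices, which is
invariant under congruences. -/
noncomputable def symmDensity (m : ℕ) : (UpperIdx m → ℝ) → ℝ≥0∞ :=
  (posDefCoords m).indicator fun x => ENNReal.ofReal ((symmOfUpper x).det ^ (-((m : ℝ) + 1) / 2))

theorem measurable_symmDensity : Measurable (symmDensity m) := by
  refine Measurable.indicator ?_ (measurableSet_posDefCoords m)
  have h : Measurable fun x : UpperIdx m → ℝ => (symmOfUpper x).det :=
    measurable_matrix_det.comp measurable_symmOfUpper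
  exact Measurable.ennreal_ofReal (by fun_prop)

theorem symmDensity_ne_zero {x : UpperIdx m → ℝ} (hx : symmDensity m x ≠ 0) :
    (symmOfUpper x).PosDef :=
  (Set.mem_of_indicator_ne_zero hx : x ∈ posDefCoords m)

theorem symmDensity_ne_top (x : UpperIdx m → ℝ) : symmDensity m x ≠ ∞ := by
  by_cases hx : x ∈ posDefCoords m <;> simp [symmDensity, hx]

/-- The image of the invariant measure on positive definite matrices under the factorization. -/
noncomputable def symmHaar (m : ℕ) : Measure (UpperPos m) :=
  (volume.withDensity (symmDensity m)).map fun x => UpperPos.factor (symmOfUpper x)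

theorem measurable_factor_symmOfUpper :
    Measurable fun x : UpperIdx m → ℝ => UpperPos.factor (symmOfUpper x) :=
  UpperPos.measurable_factor.comp measurable_symmOfUpper

instance : (symmHaar m).IsMulLeftInvariant := by
  have hpos : ∀ L : UpperPos m, 0 < L.1.det ^ (m + 1) := fun L => pow_pos L.det_pos _
  have hmem : ∀ (L : UpperPos m) x, conjLin L.1 x ∈ posDefCoords m ↔ x ∈ posDefCoords m := by
    intro L x
    change (symmOfUpper (conjLin L.1 x)).PosDef ↔ (symmOfUpper x).PosDef
    rw [symmOfUpper_conjLin, UpperPos.conj_posDef_iff]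
  refine isMulLeftInvariant_map_withDensity volume measurable_factor_symmOfUpper
    measurable_symmDensity (fun L => conjLin L.1)
    (fun L => (conjLin L.1).continuous_of_finiteDimensional.measurable)
    (fun L => ENNReal.ofReal (L.1.det ^ (m + 1)))
    (fun L => by simpa using hpos L) (fun L => ENNReal.ofReal_ne_top) (fun L => ?_)
    (fun L x => ?_) fun L x hx => ?_
  · rw [Measure.map_linearMap_addHaar_eq_smul_addHaar _
      (by rw [det_conjLin]; exact (hpos L).ne'), det_conjLin, ofReal_abs_inv (hpos L)]
  · by_cases hx : x ∈ posDefCoords m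
    · have hA : 0 < (symmOfUpper x).det := Matrix.PosDef.det_pos hx
      rw [symmDensity, Set.indicator_of_mem hx, Set.indicator_of_mem ((hmem L x).mpr hx),
        ← ENNReal.ofReal_mul (hpos L).le, symmOfUpper_conjLin, Matrix.det_mul, Matrix.det_mul,
        Matrix.det_transpose]
      congr 1
      rw [show L.1.det * (symmOfUpper x).det * L.1.det = L.1.det ^ (2 : ℝ) * (symmOfUpper x).det by
        rw [Real.rpow_two]; ring, Real.mul_rpow (Real.rpow_nonneg L.det_pos.le _) hA.le,
        ← Real.rpow_mul L.det_pos.le, ← mul_assoc, ← Real.rpow_natCast, ← Real.rpow_add L.det_pos]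
      rw [show ((m + 1 : ℕ) : ℝ) + 2 * (-((m : ℝ) + 1) / 2) = 0 by push_cast; ring,
        Real.rpow_zero, one_mul]
    · rw [symmDensity, Set.indicator_of_notMem hx,
        Set.indicator_of_notMem (mt (hmem L x).mp hx), mul_zero]
  · rw [symmOfUpper_conjLin, UpperPos.factor_conj L (symmDensity_ne_zero hx)]

instance : SigmaFinite (symmHaar m) := by
  have hm : Measurable fun Z : UpperPos m => upperCoords Z.gram :=
    measurable_upperCoords.comp UpperPos.measurable_gram
  refine SigmaFinite.of_map _ hm.aemeasurable ?_
  have h1 : (symmHaar m).map (fun Z => upperCoords Z.gram) =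
      volume.withDensity (symmDensity m) := by
    rw [symmHaar, Measure.map_map hm measurable_factor_symmOfUpper]
    refine (Measure.map_congr ?_).trans Measure.map_id
    rw [Filter.EventuallyEq, ae_withDensity_iff measurable_symmDensity]
    refine ae_of_all _ fun x hx => ?_
    rw [Function.comp_apply, UpperPos.gram_factor (symmDensity_ne_zero hx),
      upperCoords_symmOfUpper, id]
  rw [h1]
  exact SigmaFinite.withDensity_of_ne_top' symmDensity_ne_top

/-- A symmetric matrix is positive definite once a large multiple of the identity is added. -/
theorem exists_nat_posDef_add_smul_one {A : Matrix (Fin m) (Fin m) ℝ} (hA : A.IsSymm) :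
    ∃ k : ℕ, (A + (k : ℝ) • (1 : Matrix (Fin m) (Fin m) ℝ)).PosDef := by
  obtain ⟨k, hk⟩ := exists_nat_gt (∑ i, ∑ j, |A i j|)
  refine ⟨k, Matrix.PosDef.of_dotProduct_mulVec_pos ?_ fun v hv => ?_⟩
  · have hA' : A.IsHermitian := by
      rwa [Matrix.IsHermitian, Matrix.conjTranspose_eq_transpose_of_trivial]
    refine hA'.add ?_
    rw [Matrix.IsHermitian, Matrix.conjTranspose_smul]
    simp
  · have hvv : 0 < v ⬝ᵥ v := by
      have h0 : 0 ≤ v ⬝ᵥ v := Finset.sum_nonneg fun i _ => mul_self_nonneg _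
      exact lt_of_le_of_ne h0 fun h => hv (dotProduct_self_eq_zero.mp h.symm)
    have hle : ∀ i, v i * v i ≤ v ⬝ᵥ v := fun i =>
      Finset.single_le_sum (f := fun i => v i * v i) (fun i _ => mul_self_nonneg _)
        (Finset.mem_univ i)
    have hquad : -((∑ i, ∑ j, |A i j|) * (v ⬝ᵥ v)) ≤ v ⬝ᵥ A *ᵥ v := by
      have hexp : v ⬝ᵥ A *ᵥ v = ∑ i, ∑ j, A i j * (v i * v j) := by
        simp only [dotProduct, Matrix.mulVec, Finset.mul_sum]
        exact Finset.sum_congr rfl fun i _ => Finset.sum_congr rfl fun j _ => by ring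
      rw [hexp, Finset.sum_mul, ← Finset.sum_neg_distrib]
      refine Finset.sum_le_sum fun i _ => ?_
      rw [Finset.sum_mul, ← Finset.sum_neg_distrib]
      refine Finset.sum_le_sum fun j _ => ?_
      have h1 : |v i * v j| ≤ v ⬝ᵥ v := by
        rw [abs_le]
        constructor <;> nlinarith [hle i, hle j, sq_nonneg (v i + v j), sq_nonneg (v i - v j)]
      have h2 : |A i j * (v i * v j)| ≤ |A i j| * (v ⬝ᵥ v) := by
        rw [abs_mul]
        exact mul_le_mul_of_nonneg_left h1 (abs_nonneg _)
      linarith [neg_abs_le (A i j * (v i * v j))]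
    rw [star_trivial, Matrix.add_mulVec, dotProduct_add, Matrix.smul_mulVec, Matrix.one_mulVec,
      dotProduct_smul, smul_eq_mul]
    nlinarith

theorem volume_posDefCoords_ne_zero : volume (posDefCoords m) ≠ 0 := by
  intro h
  -- Countably many translates of the positive definite matrices cover all symmetric matrices.
  have hcover : (⋃ k : ℕ, (fun x => x + (k : ℝ) • upperCoords (1 : Matrix (Fin m) (Fin m) ℝ)) ⁻¹'
      posDefCoords m) = Set.univ := by
    refine Set.eq_univ_of_forall fun x => Set.mem_iUnion.mpr ?_
    obtain ⟨k, hk⟩ := exists_nat_posDef_add_smul_one (symmOfUpper_isSymm x)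
    refine ⟨k, ?_⟩
    change (symmOfUpper (x + (k : ℝ) • upperCoords 1)).PosDef
    have : symmOfUpper (x + (k : ℝ) • upperCoords (1 : Matrix (Fin m) (Fin m) ℝ)) =
        symmOfUpper x + (k : ℝ) • (1 : Matrix (Fin m) (Fin m) ℝ) := by
      ext i j
      by_cases hij : i ≤ j
      · simp [symmOfUpper, upperCoords, hij]
      · simp [symmOfUpper, upperCoords, hij, Matrix.one_apply, eq_comm]
    rwa [this]
  have h0 : volume (Set.univ : Set (UpperIdx m → ℝ)) = 0 := by
    rw [← hcover]
    refine measure_iUnion_null fun k => ?_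
    rw [measure_preimage_add_right, h]
  exact IsOpen.measure_ne_zero volume isOpen_univ Set.univ_nonempty h0

/-- The Wishart weight is the density of the invariant measure times the translated weight of the
Bartlett factor, up to a constant. -/
theorem wishartWeight_eq (n : ℝ) (V : UpperPos m) (x : UpperIdx m → ℝ) :
    wishartWeight n V.gram (symmOfUpper x) = ENNReal.ofReal (V.1.det ^ n) *
      (symmDensity m x * bartlettWeight n (V⁻¹ * UpperPos.factor (symmOfUpper x))) := by
  by_cases hx : x ∈ posDefCoords m
  · have hA : (symmOfUpper x).PosDef := hx
    rw [wishartWeight, if_pos hA, symmDensity, Set.indicator_of_mem hx, bartlettWeight_inv_mul]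
    obtain ⟨Z, hZ⟩ := UpperPos.exists_gram_eq hA
    rw [← hZ, UpperPos.factor_gram, UpperPos.det_gram]
    have hV := Real.rpow_pos_of_pos V.det_pos n
    have hZd := Z.det_pos
    rw [← ENNReal.ofReal_mul (inv_nonneg.mpr hV.le),
      ← ENNReal.ofReal_mul (Real.rpow_nonneg (sq_nonneg _) _), ← ENNReal.ofReal_mul hV.le]
    congr 1
    have h1 : (Z.1.det ^ 2) ^ ((n - m - 1) / 2) =
        (Z.1.det ^ 2) ^ (-((m : ℝ) + 1) / 2) * Z.1.det ^ n := by
      rw [← Real.rpow_two, ← Real.rpow_mul hZd.le, ← Real.rpow_mul hZd.le, ← Real.rpow_add hZd]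
      congr 1; ring
    rw [h1]
    field_simp
  · have hA : ¬ (symmOfUpper x).PosDef := hx
    rw [wishartWeight, if_neg hA, symmDensity, Set.indicator_of_notMem hx, zero_mul, mul_zero]

theorem measurable_wishartWeight_symmOfUpper (n : ℝ) (V : UpperPos m) :
    Measurable fun x : UpperIdx m → ℝ => wishartWeight n V.gram (symmOfUpper x) := by
  simp only [wishartWeight_eq]
  exact (measurable_symmDensity.mul ((measurable_bartlettWeight n).comp
    ((measurable_const_mul V⁻¹).comp measurable_factor_symmOfUpper))).const_mul _

/-- A measure on matrices which is concentrated on positive definite matrices is determined by its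
image under the factorization. -/
theorem eq_map_gram_of_map_factor {α : Type*} [MeasurableSpace α] {μ : Measure α}
    {f : α → Matrix (Fin m) (Fin m) ℝ} (hf : Measurable f) (hpos : ∀ᵐ a ∂μ, (f a).PosDef)
    {ρ : Measure (UpperPos m)} (h : μ.map (fun a => UpperPos.factor (f a)) = ρ) :
    μ.map f = ρ.map UpperPos.gram := by
  have hm : Measurable fun a => UpperPos.factor (f a) := UpperPos.measurable_factor.comp hf
  rw [← h, Measure.map_map UpperPos.measurable_gram hm]
  refine Measure.map_congr ?_
  filter_upwards [hpos] with a ha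
  exact (UpperPos.gram_factor ha).symm

/-- The Bartlett decomposition of the Wishart distribution given by its density. In particular the
normalizing integral is positive and finite. -/
theorem wishartOfDensity_eq {n : ℝ} (hn : (m : ℝ) - 1 < n) (V : UpperPos m) :
    wishartOfDensity n V.gram = (bartlettLaw m n).map fun Z => (V * Z).gram := by
  obtain ⟨C, hC, h⟩ := exists_withDensity_bartlettWeight_eq hn (symmHaar m) V
  have hprob := isProbabilityMeasure_bartlettLaw hn
  have hVm := measurable_const_mul V
  have hprob' : IsProbabilityMeasure ((bartlettLaw m n).map (V * ·)) :=
    Measure.isProbabilityMeasure_map hVm.aemeasurable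
  set μ := (volume : Measure (UpperIdx m → ℝ)).withDensity
    fun x => wishartWeight n V.gram (symmOfUpper x) with hμ
  have hVn : 0 < V.1.det ^ n := Real.rpow_pos_of_pos V.det_pos n
  have hbm : Measurable fun Z => bartlettWeight n (V⁻¹ * Z) :=
    (measurable_bartlettWeight n).comp (measurable_const_mul V⁻¹)
  have hmap : μ.map (fun x => UpperPos.factor (symmOfUpper x)) =
      (ENNReal.ofReal (V.1.det ^ n) * C) • (bartlettLaw m n).map (V * ·) := by
    have h1 : μ = ENNReal.ofReal (V.1.det ^ n) • (volume.withDensity (symmDensity m)).withDensity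
        fun x => bartlettWeight n (V⁻¹ * UpperPos.factor (symmOfUpper x)) := by
      have hm2 : Measurable fun x : UpperIdx m → ℝ =>
          bartlettWeight n (V⁻¹ * UpperPos.factor (symmOfUpper x)) :=
        hbm.comp measurable_factor_symmOfUpper
      rw [← withDensity_mul _ measurable_symmDensity hm2,
        ← withDensity_smul _ (measurable_symmDensity.mul hm2), hμ]
      congr 1
      ext x
      exact wishartWeight_eq n V x
    rw [h1, Measure.map_smul, map_withDensity_comp _ measurable_factor_symmOfUpper hbm]
    change _ • (symmHaar m).withDensity _ = _
    rw [h, smul_smul]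
  have hpos : ∀ᵐ x ∂μ, (symmOfUpper x).PosDef := by
    rw [hμ, ae_withDensity_iff (measurable_wishartWeight_symmOfUpper n V)]
    refine ae_of_all _ fun x hx => ?_
    by_contra hx'
    exact hx (if_neg hx')
  have hmass : μ Set.univ = ENNReal.ofReal (V.1.det ^ n) * C := by
    have := congrArg (fun ρ : Measure (UpperPos m) => ρ Set.univ) hmap
    simpa [Measure.map_apply measurable_factor_symmOfUpper MeasurableSet.univ] using this
  have hmass0 : μ Set.univ ≠ 0 := by
    rw [hμ, withDensity_apply _ MeasurableSet.univ, setLIntegral_univ]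
    intro h0
    rw [lintegral_eq_zero_iff (measurable_wishartWeight_symmOfUpper n V)] at h0
    refine volume_posDefCoords_ne_zero (m := m) (measure_mono_null
      (t := {x | wishartWeight n V.gram (symmOfUpper x) ≠ 0}) (fun x hx => ?_) (ae_iff.mp h0))
    have hA : (symmOfUpper x).PosDef := hx
    have hd := hA.det_pos
    change wishartWeight n V.gram (symmOfUpper x) ≠ 0
    rw [wishartWeight, if_pos hA]
    simp only [ne_eq, ENNReal.ofReal_eq_zero, not_le]
    positivity
  have hint : ∫⁻ x : UpperIdx m → ℝ, wishartWeight n V.gram (symmOfUpper x) = μ Set.univ := by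
    rw [hμ, withDensity_apply _ MeasurableSet.univ, setLIntegral_univ]
  have hmassT : μ Set.univ ≠ ∞ := hmass ▸ ENNReal.mul_ne_top ENNReal.ofReal_ne_top hC
  rw [wishartOfDensity, hint, eq_map_gram_of_map_factor measurable_symmOfUpper hpos hmap, ← hmass,
    Measure.map_smul, smul_smul, ENNReal.inv_mul_cancel hmass0 hmassT, one_smul,
    Measure.map_map UpperPos.measurable_gram hVm]
  rfl

/-! ### Gaussian matrices -/

variable {N : ℕ}

/-- The `m × N` matrix with columns `y i`. -/
def columnMatrix (y : Fin N → Fin m → ℝ) : Matrix (Fin m) (Fin N) ℝ := Matrix.of fun a i => y i a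

/-- The product of a matrix with its transpose, for the `m × N` matrix with columns `y i`. -/
def columnGram (y : Fin N → Fin m → ℝ) : Matrix (Fin m) (Fin m) ℝ :=
  columnMatrix y * (columnMatrix y)ᵀ

theorem measurable_columnGram : Measurable (columnGram (m := m) (N := N)) := by
  have h : Measurable (columnMatrix (m := m) (N := N)) :=
    measurable_of_entries fun a i => (measurable_pi_apply a).comp (measurable_pi_apply i)
  exact measurable_matrix_mul.comp (h.prodMk (measurable_matrix_transpose.comp h))

theorem columnGram_mulVec (L : Matrix (Fin m) (Fin m) ℝ) (y : Fin N → Fin m → ℝ) :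
    columnGram (fun i => L *ᵥ y i) = L * columnGram y * Lᵀ := by
  have : columnMatrix (fun i => L *ᵥ y i) = L * columnMatrix y := by
    ext a i
    simp [columnMatrix, Matrix.mul_apply, Matrix.mulVec, dotProduct]
  rw [columnGram, columnGram, this, Matrix.transpose_mul]
  simp only [Matrix.mul_assoc]

/-- If there are at least `m` columns, then almost every `m × N` matrix has full row rank. The
determinant of the first `m` columns is a nonconstant polynomial on every line parallel to the one
through the identity matrix. -/
theorem ae_posDef_columnGram (h : m ≤ N) :
    ∀ᵐ y : Fin N → Fin m → ℝ, (columnGram y).PosDef := by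
  let A : (Fin N → Fin m → ℝ) → Matrix (Fin m) (Fin m) ℝ :=
    fun y => Matrix.of fun a b => y (Fin.castLE h b) a
  let y₀ : Fin N → Fin m → ℝ := fun i a => if i = Fin.castLE h a then 1 else 0
  have hA : Measurable A :=
    measurable_of_entries fun a b => (measurable_pi_apply a).comp (measurable_pi_apply _)
  have hs : MeasurableSet {y | (A y).det ≠ 0} :=
    (measurable_matrix_det.comp hA) (measurableSet_singleton (0 : ℝ)).compl
  have hAy : ∀ y (t : ℝ), A (y + t • y₀) = Matrix.scalar (Fin m) t - -A y := by
    intro y t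
    ext a b
    by_cases hab : a = b
    · simp [A, y₀, hab, add_comm]
    · simp [A, y₀, hab, Ne.symm hab]
  have hae : ∀ᵐ y : Fin N → Fin m → ℝ, (A y).det ≠ 0 := by
    refine ae_mem_of_ae_add_linearMap_mem (LinearMap.toSpanSingleton ℝ _ y₀) volume volume hs
      fun y => ?_
    have hp : (-A y).charpoly ≠ 0 := (Matrix.charpoly_monic _).ne_zero
    have hfin : {t : ℝ | (-A y).charpoly.IsRoot t}.Finite :=
      Polynomial.finite_setOfPred_isRoot hp
    have : volume {t : ℝ | (-A y).charpoly.IsRoot t} = 0 := hfin.measure_zero _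
    filter_upwards [measure_eq_zero_iff_ae_notMem.mp this] with t ht
    change (A (y + t • y₀)).det ≠ 0
    rw [hAy, ← Matrix.eval_charpoly]
    exact ht
  filter_upwards [hae] with y hy
  have hinj : Function.Injective (columnMatrix y).vecMul := by
    intro v w hvw
    have hu : Function.Injective (A y).vecMul :=
      Matrix.vecMul_injective_iff_isUnit.mpr
        ((Matrix.isUnit_iff_isUnit_det _).mpr (isUnit_iff_ne_zero.mpr hy))
    exact hu (funext fun b => congrFun hvw (Fin.castLE h b))
  have := Matrix.PosDef.mul_conjTranspose_self (columnMatrix y) hinj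
  rwa [Matrix.conjTranspose_eq_transpose_of_trivial] at this

/-- The density of the measure `(det (Y Yᵀ)) ^ (-N / 2) dY` on `m × N` matrices of full row rank,
which is invariant under left multiplications. -/
noncomputable def columnDensity (m N : ℕ) : (Fin N → Fin m → ℝ) → ℝ≥0∞ :=
  {y | (columnGram y).PosDef}.indicator fun y =>
    ENNReal.ofReal ((columnGram y).det ^ (-(N : ℝ) / 2))

theorem measurableSet_posDef_columnGram :
    MeasurableSet {y : Fin N → Fin m → ℝ | (columnGram y).PosDef} :=
  measurable_columnGram (UpperPos.measurableSet_posDef m)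

theorem measurable_columnDensity : Measurable (columnDensity m N) := by
  refine Measurable.indicator ?_ measurableSet_posDef_columnGram
  have h : Measurable fun y : Fin N → Fin m → ℝ => (columnGram y).det :=
    measurable_matrix_det.comp measurable_columnGram
  exact Measurable.ennreal_ofReal (by fun_prop)

theorem columnDensity_ne_zero {y : Fin N → Fin m → ℝ} (hy : columnDensity m N y ≠ 0) :
    (columnGram y).PosDef :=
  (Set.mem_of_indicator_ne_zero hy : y ∈ {y | (columnGram y).PosDef})

/-- The image of the invariant measure on `m × N` matrices under the factorization of `Y Yᵀ`. -/
noncomputable def columnHaar (m N : ℕ) : Measure (UpperPos m) :=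
  (volume.withDensity (columnDensity m N)).map fun y => UpperPos.factor (columnGram y)

theorem measurable_factor_columnGram :
    Measurable fun y : Fin N → Fin m → ℝ => UpperPos.factor (columnGram y) :=
  UpperPos.measurable_factor.comp measurable_columnGram

instance : (columnHaar m N).IsMulLeftInvariant := by
  have hpos : ∀ L : UpperPos m, 0 < L.1.det ^ N := fun L => pow_pos L.det_pos _
  let M : UpperPos m → (Fin N → Fin m → ℝ) →ₗ[ℝ] (Fin N → Fin m → ℝ) := fun L =>
    LinearMap.pi fun i => (Matrix.toLin' L.1).comp (LinearMap.proj i)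
  have hdet : ∀ L, LinearMap.det (M L) = L.1.det ^ N := fun L => by
    simp only [M]
    rw [LinearMap.det_pi]
    simp
  have hM : ∀ L y, columnGram (M L y) = L.1 * columnGram y * L.1ᵀ := fun L y =>
    columnGram_mulVec L.1 y
  have hmem : ∀ L y, M L y ∈ {y : Fin N → Fin m → ℝ | (columnGram y).PosDef} ↔
      y ∈ {y : Fin N → Fin m → ℝ | (columnGram y).PosDef} := by
    intro L y
    change (columnGram (M L y)).PosDef ↔ (columnGram y).PosDef
    rw [hM, UpperPos.conj_posDef_iff]
  refine isMulLeftInvariant_map_withDensity volume measurable_factor_columnGram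
    measurable_columnDensity (fun L => M L)
    (fun L => (M L).continuous_of_finiteDimensional.measurable)
    (fun L => ENNReal.ofReal (L.1.det ^ N))
    (fun L => by simpa using hpos L) (fun L => ENNReal.ofReal_ne_top) (fun L => ?_)
    (fun L y => ?_) fun L y hy => ?_
  · rw [Measure.map_linearMap_addHaar_eq_smul_addHaar _
      (by rw [hdet]; exact (hpos L).ne'), hdet, ofReal_abs_inv (hpos L)]
  · by_cases hy : y ∈ {y : Fin N → Fin m → ℝ | (columnGram y).PosDef}
    · have hA : 0 < (columnGram y).det := Matrix.PosDef.det_pos hy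
      rw [columnDensity, Set.indicator_of_mem hy, Set.indicator_of_mem ((hmem L y).mpr hy),
        ← ENNReal.ofReal_mul (hpos L).le, hM, Matrix.det_mul, Matrix.det_mul,
        Matrix.det_transpose]
      congr 1
      rw [show L.1.det * (columnGram y).det * L.1.det = L.1.det ^ (2 : ℝ) * (columnGram y).det by
        rw [Real.rpow_two]; ring, Real.mul_rpow (Real.rpow_nonneg L.det_pos.le _) hA.le,
        ← Real.rpow_mul L.det_pos.le, ← mul_assoc, ← Real.rpow_natCast, ← Real.rpow_add L.det_pos]
      rw [show (N : ℝ) + 2 * (-(N : ℝ) / 2) = 0 by ring, Real.rpow_zero, one_mul]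
    · rw [columnDensity, Set.indicator_of_notMem hy,
        Set.indicator_of_notMem (mt (hmem L y).mp hy), mul_zero]
  · rw [hM, UpperPos.factor_conj L (columnDensity_ne_zero hy)]

/-- The law of an `m × N` matrix with independent standard normal entries. -/
noncomputable def gaussianColumns (m N : ℕ) : Measure (Fin N → Fin m → ℝ) :=
  Measure.pi fun _ => Measure.pi fun _ => gaussianReal 0 1

instance : IsProbabilityMeasure (gaussianColumns m N) := by
  unfold gaussianColumns; infer_instance

theorem pi_gaussianReal_eq_withDensity (m : ℕ) :
    (Measure.pi fun _ : Fin m => gaussianReal 0 1) =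
      volume.withDensity fun v => ENNReal.ofReal (∏ a, gaussianPDFReal 0 1 (v a)) := by
  have hgauss : gaussianReal 0 1 =
      volume.withDensity fun t => ENNReal.ofReal (gaussianPDFReal 0 1 t) := by
    rw [gaussianReal_of_var_ne_zero _ one_ne_zero]; rfl
  have hfin : ∫⁻ t, ENNReal.ofReal (gaussianPDFReal 0 1 t) ≠ ∞ := by
    rw [← setLIntegral_univ, ← withDensity_apply _ MeasurableSet.univ, ← hgauss, measure_univ]
    exact ENNReal.one_ne_top
  rw [hgauss]
  exact pi_withDensity_ofReal (fun _ => measurable_gaussianPDFReal 0 1)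
    (fun _ => gaussianPDFReal_nonneg 0 1) fun _ => hfin

theorem gaussianColumns_eq_withDensity (m N : ℕ) :
    gaussianColumns m N = volume.withDensity fun y =>
      ENNReal.ofReal (∏ i, ∏ a, gaussianPDFReal 0 1 (y i a)) := by
  let f : (Fin m → ℝ) → ℝ := fun v => ∏ a, gaussianPDFReal 0 1 (v a)
  have hf : Measurable f := Finset.measurable_prod _ fun a _ =>
    (measurable_gaussianPDFReal 0 1).comp (measurable_pi_apply a)
  have hf0 : ∀ v, 0 ≤ f v := fun v => Finset.prod_nonneg fun a _ => gaussianPDFReal_nonneg 0 1 _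
  have hfin : ∫⁻ v, ENNReal.ofReal (f v) ≠ ∞ := by
    rw [← setLIntegral_univ, ← withDensity_apply _ MeasurableSet.univ,
      ← pi_gaussianReal_eq_withDensity, measure_univ]
    exact ENNReal.one_ne_top
  have h := pi_withDensity_ofReal (ι := Fin N) (X := fun _ => Fin m → ℝ) (f := fun _ => f)
    (fun _ => hf) (fun _ => hf0) fun _ => hfin
  rw [gaussianColumns, pi_gaussianReal_eq_withDensity]
  exact h

/-- The Gaussian density depends on `Y` only through `Y Yᵀ`: it is, up to a constant, the weight of the
Bartlett factor times the density of the invariant measure. -/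
theorem gaussianColumns_eq (h : m ≤ N) : ∃ C : ℝ≥0∞, C ≠ 0 ∧ C ≠ ∞ ∧
    gaussianColumns m N = C • (volume.withDensity (columnDensity m N)).withDensity
      fun y => bartlettWeight N (UpperPos.factor (columnGram y)) := by
  have hcols := gaussianColumns_eq_withDensity m N
  have hC : 0 < ∏ _i : Fin N, ∏ _a : Fin m, (√(2 * Real.pi))⁻¹ :=
    Finset.prod_pos fun _ _ => Finset.prod_pos fun _ _ => by positivity
  refine ⟨ENNReal.ofReal (∏ _i : Fin N, ∏ _a : Fin m, (√(2 * Real.pi))⁻¹), by simpa using hC,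
    ENNReal.ofReal_ne_top, ?_⟩
  have hm : Measurable fun y : Fin N → Fin m → ℝ =>
      bartlettWeight N (UpperPos.factor (columnGram y)) :=
    (measurable_bartlettWeight N).comp measurable_factor_columnGram
  rw [hcols, ← withDensity_mul _ measurable_columnDensity hm,
    ← withDensity_smul _ (measurable_columnDensity.mul hm)]
  refine withDensity_congr_ae ?_
  filter_upwards [ae_posDef_columnGram h] with y hy
  have htr : (columnGram y).trace = ∑ i, ∑ a, y i a ^ 2 := by
    simp only [columnGram, columnMatrix, Matrix.trace, Matrix.diag, Matrix.mul_apply,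
      Matrix.transpose_apply, Matrix.of_apply]
    rw [Finset.sum_comm]
    simp only [sq]
  obtain ⟨Z, hZ⟩ := UpperPos.exists_gram_eq hy
  have hZd := Z.det_pos
  simp only [Pi.smul_apply, Pi.mul_apply, smul_eq_mul]
  rw [columnDensity, Set.indicator_of_mem (by exact hy), bartlettWeight, ← hZ,
    UpperPos.factor_gram, UpperPos.det_gram, hZ, htr,
    ← ENNReal.ofReal_mul (Real.rpow_nonneg (sq_nonneg _) _), ← ENNReal.ofReal_mul hC.le]
  congr 1
  have hdet : (Z.1.det ^ 2) ^ (-(N : ℝ) / 2) * Z.1.det ^ (N : ℝ) = 1 := by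
    rw [← Real.rpow_two, ← Real.rpow_mul hZd.le, ← Real.rpow_add hZd]
    rw [show 2 * (-(N : ℝ) / 2) + N = 0 by ring, Real.rpow_zero]
  have hpdf : ∀ t, gaussianPDFReal 0 1 t =
      (√(2 * Real.pi))⁻¹ * Real.exp (-(1 / 2) * t ^ 2) := fun t => by
    rw [gaussianPDFReal]
    simp only [NNReal.coe_one, mul_one, sub_zero]
    rw [show -(1 / 2) * t ^ 2 = -t ^ 2 / 2 by ring]
  simp only [hpdf, Finset.prod_mul_distrib, ← Real.exp_sum, ← Finset.mul_sum]
  linear_combination (-(∏ _i : Fin N, ∏ _a : Fin m, (√(2 * Real.pi))⁻¹) *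
    Real.exp (-(1 / 2) * ∑ i, ∑ a, y i a ^ 2)) * hdet

/-- For a Gaussian matrix `Y` with independent standard normal entries, the factor of `Y Yᵀ` has the
law of the Bartlett factor. -/
theorem map_factor_gaussianColumns (h : m ≤ N) :
    (gaussianColumns m N).map (fun y => UpperPos.factor (columnGram y)) = bartlettLaw m N := by
  have hn : (m : ℝ) - 1 < N := by
    have : (m : ℝ) ≤ N := Nat.cast_le.mpr h
    linarith
  have hb := measurable_bartlettWeight (m := m) (N : ℝ)
  obtain ⟨C, hC0, hC, hg⟩ := gaussianColumns_eq h
  have h1 : (gaussianColumns m N).map (fun y => UpperPos.factor (columnGram y)) =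
      C • (columnHaar m N).withDensity (bartlettWeight N) := by
    rw [hg, Measure.map_smul, map_withDensity_comp _ measurable_factor_columnGram hb, columnHaar]
  have hp1 : IsProbabilityMeasure
      ((gaussianColumns m N).map fun y => UpperPos.factor (columnGram y)) :=
    Measure.isProbabilityMeasure_map measurable_factor_columnGram.aemeasurable
  -- The invariant measure is σ-finite because its multiple by the weight is finite.
  have hsf : SigmaFinite (columnHaar m N) := by
    have hw0 : ∀ Z : UpperPos m, bartlettWeight N Z ≠ 0 := fun Z => by
      have := Z.det_pos
      simp only [bartlettWeight, ne_eq, ENNReal.ofReal_eq_zero, not_le]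
      positivity
    have hfin : (columnHaar m N).withDensity (bartlettWeight N) =
        C⁻¹ • (gaussianColumns m N).map fun y => UpperPos.factor (columnGram y) := by
      rw [h1, smul_smul, ENNReal.inv_mul_cancel hC0 hC, one_smul]
    have hfin' : IsFiniteMeasure ((columnHaar m N).withDensity (bartlettWeight N)) := by
      rw [hfin]
      exact Measure.smul_finite _ (ENNReal.inv_ne_top.mpr hC0)
    rw [← withDensity_inv_same hb (μ := columnHaar m N) (ae_of_all _ hw0)
      (ae_of_all _ fun Z => ENNReal.ofReal_ne_top)]
    exact SigmaFinite.withDensity_of_ne_top' fun Z => ENNReal.inv_ne_top.mpr (hw0 Z)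
  have hp2 := isProbabilityMeasure_bartlettLaw hn
  obtain ⟨D, -, hD⟩ := exists_withDensity_bartlettWeight_eq hn (columnHaar m N) 1
  simp only [inv_one, one_mul] at hD
  refine eq_of_eq_smul_of_isProbabilityMeasure (a := C * D) (b := 1)
    (ρ := (bartlettLaw m N).map id) ?_ ?_
  · rw [h1, ← smul_smul]
    exact congrArg _ hD
  · rw [Measure.map_id, one_smul]

/-- A linear image of a standard normal vector is normal. -/
theorem multivariateGaussian_zero_mul_transpose (V : Matrix (Fin m) (Fin m) ℝ) :
    multivariateGaussian 0 (V * Vᵀ) =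
      (Measure.pi fun _ => gaussianReal 0 1).map fun x => WithLp.toLp 2 (V *ᵥ x) := by
  have hS : (V * Vᵀ).PosSemidef := by
    simpa using Matrix.posSemidef_self_mul_conjTranspose V
  have h1 : (Measure.pi fun _ => gaussianReal 0 1).map (fun x => WithLp.toLp 2 (V *ᵥ x)) =
      (stdGaussian (EuclideanSpace ℝ (Fin m))).map (toEuclideanCLM (𝕜 := ℝ) V) := by
    rw [← map_pi_eq_stdGaussian, Measure.map_map (by fun_prop) (by fun_prop)]
    rfl
  rw [h1]
  refine Measure.ext_of_charFun (funext fun t => ?_)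
  have h2 : charFun ((stdGaussian (EuclideanSpace ℝ (Fin m))).map (toEuclideanCLM (𝕜 := ℝ) V)) t =
      charFun (stdGaussian (EuclideanSpace ℝ (Fin m))) (toEuclideanCLM (𝕜 := ℝ) Vᵀ t) := by
    rw [charFun_apply, charFun_apply, integral_map (by fun_prop) (by fun_prop)]
    refine integral_congr_ae (ae_of_all _ fun x => ?_)
    simp only
    congr 3
    rw [real_inner_comm, inner_toEuclideanCLM, inner_toEuclideanCLM, Matrix.dotProduct_mulVec,
      ← Matrix.mulVec_transpose, dotProduct_comm]
  rw [h2, charFun_multivariateGaussian hS, charFun_stdGaussian, inner_zero_right]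
  congr 1
  have h3 : ‖toEuclideanCLM (𝕜 := ℝ) Vᵀ t‖ ^ 2 = t ⬝ᵥ (V * Vᵀ) *ᵥ t := by
    rw [← real_inner_self_eq_norm_sq, inner_toEuclideanCLM, ← Matrix.mulVec_mulVec,
      Matrix.dotProduct_mulVec t, ← Matrix.mulVec_transpose]
    rfl
  rw [← h3]
  push_cast
  ring

theorem wishartGaussian_eq (h : m ≤ N) (V : UpperPos m) :
    wishartGaussian N V.gram = (bartlettLaw m N).map fun Z => (V * Z).gram := by
  have hmv : Measurable fun x : Fin m → ℝ => WithLp.toLp 2 (V.1 *ᵥ x) := by fun_prop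
  have hpi : (Measure.pi fun _ : Fin N => multivariateGaussian 0 V.gram) =
      (gaussianColumns m N).map fun y i => WithLp.toLp 2 (V.1 *ᵥ y i) := by
    rw [gaussianColumns, UpperPos.gram, multivariateGaussian_zero_mul_transpose,
      Measure.pi_map_pi fun _ => hmv.aemeasurable]
  have hm1 : Measurable fun (y : Fin N → Fin m → ℝ) (i : Fin N) =>
      WithLp.toLp 2 (V.1 *ᵥ y i) :=
    measurable_pi_lambda _ fun i => hmv.comp (measurable_pi_apply i)
  have hm2 : Measurable fun y : Fin N → EuclideanSpace ℝ (Fin m) =>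
      (Matrix.of fun a i => y i a) * (Matrix.of fun a i => y i a)ᵀ := by
    have : Measurable fun (y : Fin N → EuclideanSpace ℝ (Fin m)) (i : Fin N) (a : Fin m) =>
        y i a := by fun_prop
    exact measurable_columnGram.comp this
  have hac : gaussianColumns m N ≪ volume := by
    obtain ⟨C, -, -, hg⟩ := gaussianColumns_eq h
    rw [hg]
    exact Measure.AbsolutelyContinuous.smul_left
      ((withDensity_absolutelyContinuous _ _).trans (withDensity_absolutelyContinuous _ _)) _
  rw [wishartGaussian, hpi, Measure.map_map hm2 hm1]
  have hcomp : ((fun y : Fin N → EuclideanSpace ℝ (Fin m) =>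
      (Matrix.of fun a i => y i a) * (Matrix.of fun a i => y i a)ᵀ) ∘
      fun (y : Fin N → Fin m → ℝ) (i : Fin N) => WithLp.toLp 2 (V.1 *ᵥ y i)) =
      (fun A => V.1 * A * V.1ᵀ) ∘ columnGram := by
    ext1 y
    exact columnGram_mulVec V.1 y
  have hconj : Measurable fun A : Matrix (Fin m) (Fin m) ℝ => V.1 * A * V.1ᵀ :=
    ((continuous_const.matrix_mul continuous_id).matrix_mul continuous_const).measurable
  rw [hcomp, ← Measure.map_map hconj measurable_columnGram,
    eq_map_gram_of_map_factor measurable_columnGram (hac.ae_le (ae_posDef_columnGram h))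
      (map_factor_gaussianColumns h), Measure.map_map hconj UpperPos.measurable_gram]
  congr 1
  ext1 Z
  exact (UpperPos.gram_mul V Z).symm

/-- **Bartlett decomposition**: if `S = V Vᵀ`, then `W_m(n, S)` is the law of `(V Z) (V Z)ᵀ` for the
Bartlett factor `Z`. -/
theorem wishart_eq {n : ℝ} (hn : (m : ℝ) - 1 < n) (V : UpperPos m) :
    wishart n V.gram = (bartlettLaw m n).map fun Z => (V * Z).gram := by
  rw [wishart]
  split_ifs with hint
  · have hmN : m ≤ ⌊n⌋₊ := by
      rw [← hint] at hn
      have : (m : ℝ) < (⌊n⌋₊ + 1 : ℕ) := by push_cast; linarith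
      exact Nat.lt_succ_iff.mp (Nat.cast_lt.mp this)
    rw [wishartGaussian_eq hmN V, hint]
  · exact wishartOfDensity_eq hn V

/-! ### The Cholesky-inverse-Wishart distribution -/

theorem cholU_of_posDef {A : Matrix (Fin m) (Fin m) ℝ} (hA : A.PosDef) :
    cholU A = (UpperPos.factor A⁻¹)⁻¹.1 := by
  have h := UpperPos.cholU_inv_gram (UpperPos.factor A⁻¹)
  rwa [UpperPos.gram_factor hA.inv, Matrix.nonsing_inv_nonsing_inv _ hA.det_pos.ne'.isUnit] at h

theorem cholU_of_not_posDef {A : Matrix (Fin m) (Fin m) ℝ} (hA : ¬ A.PosDef) : cholU A = 0 := by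
  refine dif_neg fun ⟨U, hU⟩ => hA ?_
  let U' : UpperPos m := ⟨U, hU.upper, hU.diag_pos⟩
  have h := (UpperPos.gram_posDef U'⁻¹).inv
  rwa [UpperPos.gram, UpperPos.val_inv, Matrix.mul_inv_rev, ← Matrix.transpose_nonsing_inv,
    Matrix.nonsing_inv_nonsing_inv _ U'.isUnit_det, ← hU.eq_mul] at h

theorem measurable_cholU : Measurable (cholU (m := m)) := by
  classical
  have : (cholU (m := m)) = fun A => if A.PosDef then (UpperPos.factor A⁻¹)⁻¹.1 else 0 := by
    ext1 A
    split_ifs with hA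
    · exact cholU_of_posDef hA
    · exact cholU_of_not_posDef hA
  rw [this]
  exact Measurable.ite (UpperPos.measurableSet_posDef m)
    (UpperPos.measurable_val.comp (UpperPos.measurable_factor.comp measurable_matrix_inv).inv)
    measurable_const

theorem cholInvWishart_eq {n : ℝ} (hn : (m : ℝ) - 1 < n) (U : UpperPos m) :
    cholInvWishart n U.1 = (bartlettLaw m n).map fun Z => Z.1⁻¹ * U.1 := by
  have hS : (U.1ᵀ * U.1)⁻¹ = U⁻¹.gram := by
    rw [UpperPos.gram, Matrix.mul_inv_rev, UpperPos.val_inv, Matrix.transpose_nonsing_inv]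
  have hm : Measurable fun Z : UpperPos m => (U⁻¹ * Z).gram :=
    UpperPos.measurable_gram.comp (measurable_const_mul _)
  rw [cholInvWishart, invWishart, hS, wishart_eq hn,
    Measure.map_map measurable_matrix_inv hm,
    Measure.map_map measurable_cholU (measurable_matrix_inv.comp hm)]
  congr 1
  ext1 Z
  rw [Function.comp_apply, Function.comp_apply, UpperPos.cholU_inv_gram, ← UpperPos.val_inv,
    _root_.mul_inv_rev, inv_inv]
  rfl

/-- The condition on the entries of `Z` says that their joint law is that of the entries of the
Bartlett factor. -/
theorem iIndepFun_and_hasLaw_iff_hasLaw_entriesLaw {α : Type*} [MeasurableSpace α]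
    {P : Measure α} [IsProbabilityMeasure P] {n : ℝ} (hn : (m : ℝ) - 1 < n)
    {Z : α → Matrix (Fin m) (Fin m) ℝ} :
    (iIndepFun (fun (p : UpperIdx m) ω => Z ω p.1.1 p.1.2) P ∧
      (∀ i j : Fin m, i < j → HasLaw (fun ω => Z ω i j) (gaussianReal 0 1) P) ∧
      (∀ j : Fin m, HasLaw (fun ω => Z ω j j) (chi (n - m + (j.val + 1))) P)) ↔
    HasLaw (fun ω => upperCoords (Z ω)) (entriesLaw m n) P := by
  have := isProbabilityMeasure_entryLaw (m := m) hn
  constructor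
  · rintro ⟨hind, hoff, hdiag⟩
    refine iIndepFun.hasLaw_pi (fun p => ?_) hind
    rcases eq_or_lt_of_le p.2 with h | h
    · have h1 : entryLaw n p = chi (n - m + (p.1.2.val + 1)) := if_pos h
      have h2 : (fun ω => upperCoords (Z ω) p) = fun ω => Z ω p.1.2 p.1.2 := by
        simp only [upperCoords, h]
      rw [h1]
      exact h2 ▸ hdiag p.1.2
    · have h1 : entryLaw n p = gaussianReal 0 1 := if_neg h.ne
      rw [h1]
      exact hoff _ _ h
  · intro hX
    have hp : ∀ p : UpperIdx m, HasLaw (fun ω => Z ω p.1.1 p.1.2) (entryLaw n p) P := fun p =>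
      (measurePreserving_eval (fun p : UpperIdx m => entryLaw n p) p).hasLaw.comp hX
    refine ⟨(iIndepFun_iff_hasLaw_pi_pi hp).mpr hX, fun i j hij => ?_, fun j => ?_⟩
    · have h1 : entryLaw n ⟨(i, j), hij.le⟩ = gaussianReal 0 1 := if_neg hij.ne
      exact h1 ▸ hp ⟨(i, j), hij.le⟩
    · have h1 : entryLaw n (diagIdx j) = chi (n - m + (j.val + 1)) := if_pos rfl
      exact h1 ▸ hp (diagIdx j)

end InvWishart

theorem mainTheorem1 {α : Type*} [MeasurableSpace α] (P : Measure α) [IsProbabilityMeasure P]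
    (m : ℕ) (n : ℝ) (hn : (m : ℝ) - 1 < n)
    (Ω U_Ω : Matrix (Fin m) (Fin m) ℝ) (hΩ : Ω.PosDef) (hU : InvWishart.IsUpperCholesky U_Ω Ω)
    (Z U_B : α → Matrix (Fin m) (Fin m) ℝ) (hZ : AEMeasurable Z P)
    (hZ_upper : ∀ᵐ ω ∂P, (Z ω).IsUpperTriangular)
    (hU_B : ∀ᵐ ω ∂P, U_B ω = (Z ω)⁻¹ * U_Ω) :
    HasLaw U_B (InvWishart.cholInvWishart n U_Ω) P ↔
      iIndepFun (fun (p : InvWishart.UpperIdx m) ω => Z ω p.1.1 p.1.2) P ∧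
      (∀ i j : Fin m, i < j → HasLaw (fun ω => Z ω i j) (gaussianReal 0 1) P) ∧
      (∀ j : Fin m, HasLaw (fun ω => Z ω j j) (InvWishart.chi (n - m + (j.val + 1))) P) := by
  open InvWishart in
  rw [iIndepFun_and_hasLaw_iff_hasLaw_entriesLaw hn]
  let U : UpperPos m := ⟨U_Ω, hU.upper, hU.diag_pos⟩
  have hlaw : cholInvWishart n U_Ω = (bartlettLaw m n).map fun W => W.1⁻¹ * U.1 :=
    cholInvWishart_eq hn U
  have hmul : Measurable fun A : Matrix (Fin m) (Fin m) ℝ => A * U.1 :=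
    (continuous_id.matrix_mul continuous_const).measurable
  have hmulU : Measurable fun A : Matrix (Fin m) (Fin m) ℝ => U.1 * A :=
    (continuous_const.matrix_mul continuous_id).measurable
  have hf : Measurable fun W : UpperPos m => W.1⁻¹ * U.1 :=
    hmul.comp (measurable_matrix_inv.comp UpperPos.measurable_val)
  have hX : AEMeasurable (fun ω => upperCoords (Z ω)) P :=
    measurable_upperCoords.comp_aemeasurable hZ
  have hUB : AEMeasurable U_B P :=
    ((hmul.comp measurable_matrix_inv).comp_aemeasurable hZ).congr
      (hU_B.mono fun ω h => h.symm)
  constructor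
  · intro hB
    have hg : Measurable fun A : Matrix (Fin m) (Fin m) ℝ => upperCoords (U.1 * A⁻¹) :=
      measurable_upperCoords.comp (hmulU.comp measurable_matrix_inv)
    -- The law of `U_B` charges invertible matrices only, and `Z⁻¹` is `0` for singular `Z`.
    have hdet : ∀ᵐ ω ∂P, (U_B ω).det ≠ 0 := by
      have hs : MeasurableSet {A : Matrix (Fin m) (Fin m) ℝ | A.det ≠ 0} :=
        measurable_matrix_det (measurableSet_singleton (0 : ℝ)).compl
      have h1 : ∀ᵐ A ∂P.map U_B, A.det ≠ 0 := by
        rw [hB.map_eq, hlaw]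
        refine (ae_map_iff hf.aemeasurable hs).mpr (ae_of_all _ fun W => ?_)
        rw [Matrix.det_mul]
        exact mul_ne_zero W⁻¹.det_pos.ne' U.det_pos.ne'
      exact ae_of_ae_map hUB h1
    have hXg : (fun ω => upperCoords (U.1 * (U_B ω)⁻¹)) =ᵐ[P] fun ω => upperCoords (Z ω) := by
      filter_upwards [hU_B, hdet] with ω h1 h2
      have hZi : IsUnit (Z ω)⁻¹.det := by
        rw [h1, Matrix.det_mul] at h2
        exact isUnit_iff_ne_zero.mpr (left_ne_zero_of_mul h2)
      have hZu : IsUnit (Z ω).det := Matrix.isUnit_nonsing_inv_det_iff.mp hZi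
      rw [h1, Matrix.mul_inv_rev, Matrix.nonsing_inv_nonsing_inv _ hZu, ← Matrix.mul_assoc]
      change upperCoords (U.1 * U.1⁻¹ * Z ω) = _
      rw [Matrix.mul_nonsing_inv _ U.isUnit_det, Matrix.one_mul]
    refine ⟨hX, ?_⟩
    have h3 : P.map (fun ω => upperCoords (U.1 * (U_B ω)⁻¹)) = (P.map U_B).map
        fun A => upperCoords (U.1 * A⁻¹) :=
      (AEMeasurable.map_map_of_aemeasurable hg.aemeasurable hUB).symm
    have hc : Measurable fun W : UpperPos m => upperCoords W.1 :=
      measurable_upperCoords.comp UpperPos.measurable_val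
    have h4 : ((fun A => upperCoords (U.1 * A⁻¹)) ∘ fun W : UpperPos m => W.1⁻¹ * U.1) =
        fun W => upperCoords W.1 := by
      ext1 W
      rw [Function.comp_apply, Matrix.mul_inv_rev, Matrix.nonsing_inv_nonsing_inv _ W.isUnit_det,
        ← Matrix.mul_assoc, Matrix.mul_nonsing_inv _ U.isUnit_det, Matrix.one_mul]
    rw [← Measure.map_congr hXg, h3, hB.map_eq, hlaw, Measure.map_map hg hf, h4, bartlettLaw,
      Measure.map_map hc UpperPos.measurable_ofCoords]
    refine (Measure.map_congr ?_).trans Measure.map_id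
    filter_upwards [ae_entriesLaw_mem_posDiag hn] with x hx
    exact UpperPos.upperCoords_ofCoords hx
  · intro hL
    have hmem : ∀ᵐ ω ∂P, upperCoords (Z ω) ∈ posDiag m :=
      ae_of_ae_map hX (hL.map_eq ▸ ae_entriesLaw_mem_posDiag hn)
    have hUBf : U_B =ᵐ[P] fun ω => (UpperPos.ofCoords (upperCoords (Z ω))).1⁻¹ * U.1 := by
      filter_upwards [hU_B, hmem, hZ_upper] with ω h1 h2 h3
      rw [h1, UpperPos.val_ofCoords h2, triOfUpper_upperCoords h3]
    refine ⟨hUB, ?_⟩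
    have h5 : P.map (fun ω => (UpperPos.ofCoords (upperCoords (Z ω))).1⁻¹ * U.1) =
        (P.map fun ω => upperCoords (Z ω)).map fun x => (UpperPos.ofCoords x).1⁻¹ * U.1 :=
      (AEMeasurable.map_map_of_aemeasurable
        (hf.comp UpperPos.measurable_ofCoords).aemeasurable hX).symm
    rw [Measure.map_congr hUBf, h5, hL.map_eq, hlaw, bartlettLaw,
      Measure.map_map hf UpperPos.measurable_ofCoords]
    rfl
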